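/- **Setting.** A bilinear algorithm with $r$ products for $m\times k$ by $k\times n$ matrices is a triple of real matrices $L\in\mathbb R^{r\times mk}$, $R\in\mathbb R^{r\times kn}$, $P\in\mathbb R^{mn\times r}$; it is an $\langle m,k,n:r\rangle$ matrix multiplication algorithm if $P\big((L\,\mathrm{vec}A)\odot(R\,\mathrm{vec}B)\big)=\mathrm{vec}(AB)$ for all real $A,B$, where $\mathrm{vec}$ is row-major vectorization and $\odot$ the entrywise product. For $p,q\in[1,\infty]$, with $q^*$ the conjugate exponent of $q$, its $(p,q)$-growth factor is $$\gamma_{p,q}=\Big\|\Big(\sum_{i=1}^{r}\|L_{i}\|_{q^*}\,\|R_{i}\|_{q^*}\,|P_{j,i}|\Big)_{j}\Big\|_p ,$$ where $L_i,R_i$ are the $i$-th rows, and its error bound exponent is $\log_k\gamma_{p,q}$. For a matrix, $\|A\|_p$ is the $p$-norm of the vector of its coefficients. The algorithm is used recursively: it is applied on $\ell$ levels to an $m_0m^\ell\times k_0k^\ell$ matrix $A$ and a $k_0k^\ell\times n_0n^\ell$ matrix $B$ ($m_0,k_0,n_0\ge1$), cut into blocks, and the $m_0\times k_0$ by $k_0\times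 n_0$ products at the bottom are performed by a fixed bilinear matrix multiplication algorithm. Let $K=k_0k^\ell$. In floating-point arithmetic each scalar operation returns $(x\ \mathrm{op}\ y)(1+\delta)$ with $|\delta|\le\varepsilon\le 1$; the linear forms given by the rows of $L$, $R$, $P$ are evaluated directly, by multiplications by the coefficients and additions in any order. Let $\widehat C$ be any matrix that can be computed in this way. We say that the algorithm *satisfies the $(p,q)$ error bound* if for every bottom algorithm there is $f_{p,q}$, a function of $\ell$, with $$\|\widehat C-AB\|_p\le f_{p,q}(\ell)\,\|A\|_q\|B\|_q\,\varepsilon+O(\varepsilon^2),\qquad f_{p,q}=O(\gamma_{p,q}^{\,\ell})=O\big((K/k_0)^{\log_k\gamma_{p,q}}\big)=O\big(K^{\log_k\gamma_{p,q}}\big),$$ where, for each $\ell$, the remainder $O(\varepsilon^2)$ is at most $D_\ell\|A\|_q\|B\|_q\varepsilon^2$ with $D_\ell$ independent of $A$, $B$, $\varepsilon$ and of the rounding errors. **Theorem.** Let $(L,R,P)$ be the new accurate rational algorithm for $4\times4$ matrices with $48$ products (the explicit matrices $L$, $R$ and $8P$ are `newL`, `newR` and `newP8` in the formal definitions). 1.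 It is a $\langle4,4,4:48\rangle$ matrix multiplication algorithm, and its growth factors are $$\gamma_{\infty,\infty}=224,\quad \gamma_{\infty,2}=16+8\sqrt2\approx27.314,\quad \gamma_{2,\infty}=896,\quad \gamma_{2,2}=64+32\sqrt2\approx109.26$$ (decimal values are rounded, here upwards; they hold within $10^{-3}$ and $10^{-2}$ respectively). 2. It satisfies the $(p,q)$ error bound for all $p,q\in\{2,\infty\}$, with error bound exponents $\log_4\gamma_{p,q}$ within $10^{-3}$ of $3.904$, $2.386$, $4.904$, $3.386$ for $(p,q)=(\infty,\infty),(\infty,2),(2,\infty),(2,2)$. In particular the error measured in max-norm, with inputs measured in $2$-norm, has error bound exponent $\log_4\gamma_{\infty,2}\approx2.386$. 3. The following sub-cubic algorithms are matrix multiplication algorithms and satisfy the $(\infty,2)$ error bound: Winograd's $\langle2,2,2:7\rangle$ variant (1977), with $\gamma_{\infty,2}=8$; Strassen's $\langle2,2,2:7\rangle$ algorithm (1969), with $\gamma_{\infty,2}\approx6.829$; the accurate $\langle2,2,2:7\rangle$ variant of Dumas, Pernet and Sedoglavic (2024), with $\gamma_{\infty,2}\approx5.966$; the rational $\langle4,4,4:48\rangle$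 algorithm of Dumas, Pernet and Sedoglavic (2025), with $\gamma_{\infty,2}\approx38.163$ (approximate values hold within $10^{-3}$; the matrices, for the last two in a representation with the published growth factors, are in the formal definitions). The exponent $\log_4\gamma_{\infty,2}$ of the new algorithm is strictly smaller than the exponent $\log_k\gamma_{\infty,2}$ of each of these four algorithms ($k=2$ for the first three, $k=4$ for the last). -/

import Mathlib

open Filter Asymptotics
open scoped ENNReal Matrix

/-! ### Bilinear (LRP) algorithms and their growth factors -/

/-- A bilinear algorithm with `r` products for the product of an `m × k` matrix by a `k × n` matrix,
given by its three matrices `L`, `R`, `P`. -/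
structure LRP (m k n r : ℕ) where
  L : Matrix (Fin r) (Fin (m * k)) ℝ
  R : Matrix (Fin r) (Fin (k * n)) ℝ
  P : Matrix (Fin (m * n)) (Fin r) ℝ

/-- Row-major vectorization: the entry of index `i * k + j` is `A i j`. -/
def rowVec {m k : ℕ} (A : Matrix (Fin m) (Fin k) ℝ) : Fin (m * k) → ℝ :=
  fun x => A (finProdFinEquiv.symm x).1 (finProdFinEquiv.symm x).2

/-- The `p`-norm of a real vector. -/
noncomputable def vecNorm (p : ℝ≥0∞) {ι : Type} [Fintype ι] (v : ι → ℝ) : ℝ :=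
  ‖WithLp.toLp p v‖

/-- The `p`-norm of the vector of the coefficients of a matrix (not an operator norm). -/
noncomputable def matNorm (p : ℝ≥0∞) {m k : ℕ} (A : Matrix (Fin m) (Fin k) ℝ) : ℝ :=
  vecNorm p (rowVec A)

namespace LRP

variable {m k n r : ℕ}

/-- The bilinear map `(A, B) ↦ P ((L vec A) ⊙ (R vec B))` defined by an LRP representation. -/
def beta (alg : LRP m k n r) (A : Matrix (Fin m) (Fin k) ℝ) (B : Matrix (Fin k) (Fin n) ℝ) :
    Fin (m * n) → ℝ :=
  alg.P *ᵥ ((alg.L *ᵥ rowVec A) * (alg.R *ᵥ rowVec B))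

/-- The representation is one of matrix multiplication: in exact arithmetic it returns `A * B`. -/
def IsMatMul (alg : LRP m k n r) : Prop :=
  ∀ (A : Matrix (Fin m) (Fin k) ℝ) (B : Matrix (Fin k) (Fin n) ℝ), alg.beta A B = rowVec (A * B)

/-- The `(p, q)`-growth factor
`‖ (∑ i, ‖row i of L‖_{q*} ‖row i of R‖_{q*} |P j i|)_j ‖_p`, where `q*` is the conjugate exponent
of `q`, that is the exponent of the dual norm of the `q`-norm. -/
noncomputable def growthFactor (alg : LRP m k n r) (p q : ℝ≥0∞) : ℝ :=
  vecNorm p fun j => ∑ i, vecNorm q.conjExponent (alg.L i) * vecNorm q.conjExponent (alg.R i) *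
    |alg.P j i|

/-- The error bound exponent `log_k γ_{p,q}`. -/
noncomputable def errorExponent (alg : LRP m k n r) (p q : ℝ≥0∞) : ℝ :=
  Real.logb k (alg.growthFactor p q)

end LRP

/-! ### Recursive evaluation in rounded arithmetic

Every elementary operation `x op y` returns `(x op y) (1 + δ)` for some `δ` with `|δ| ≤ ε`. The
values that can be computed are described by relations, so that the rounding errors of distinct
operations are unrelated and the terms of a sum can be added in any order. -/

/-- `FlSum ε s z`: the value `z` can be obtained by adding up the nonempty multiset `s`, in some
order and with some parenthesization, by rounded additions. -/
inductive FlSum (ε : ℝ) : Multiset ℝ → ℝ → Prop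
  | single (x : ℝ) : FlSum ε {x} x
  | add (s t : Multiset ℝ) (x y δ : ℝ) (hδ : |δ| ≤ ε) (hx : FlSum ε s x) (hy : FlSum ε t y) :
      FlSum ε (s + t) ((x + y) * (1 + δ))

/-- `FlMul ε x y z`: the value `z` is a rounded product of `x` and `y`. -/
def FlMul (ε x y z : ℝ) : Prop := ∃ δ : ℝ, |δ| ≤ ε ∧ z = x * y * (1 + δ)

/-- `FlDot ε c v z`: the value `z` can be computed for the linear combination `∑ x, c x * v x`
(nonempty), by rounded multiplications followed by rounded additions. -/
def FlDot (ε : ℝ) {ι : Type} [Fintype ι] (c v : ι → ℝ) (z : ℝ) : Prop :=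
  ∃ t : ι → ℝ, (∀ x, FlMul ε (c x) (v x) (t x)) ∧ FlSum ε (Finset.univ.val.map t) z

/-- The dimension `m₀ * m ^ ℓ` of the matrices handled with `ℓ` levels of recursion. -/
def recDim (m m₀ : ℕ) : ℕ → ℕ
  | 0 => m₀
  | ℓ + 1 => m * recDim m m₀ ℓ

/-- The `x`-th block (blocks are numbered in row-major order) of a matrix cut in `m × k` blocks. -/
def block {m k M K : ℕ} (A : Matrix (Fin (m * M)) (Fin (k * K)) ℝ) (x : Fin (m * k)) :
    Matrix (Fin M) (Fin K) ℝ :=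
  fun a b => A (finProdFinEquiv ((finProdFinEquiv.symm x).1, a))
    (finProdFinEquiv ((finProdFinEquiv.symm x).2, b))

namespace LRP

variable {m k n r m₀ k₀ n₀ r₀ : ℕ}

/-- `alg.Computed base ε ℓ A B C`: the matrix `C` can be returned, in arithmetic of precision `ε`,
by `ℓ` recursive levels of `alg` on `A` and `B`, the `m₀ × k₀` by `k₀ × n₀` products at the bottom
of the recursion being performed by the algorithm `base`. -/
def Computed (alg : LRP m k n r) (base : LRP m₀ k₀ n₀ r₀) (ε : ℝ) :
    (ℓ : ℕ) → Matrix (Fin (recDim m m₀ ℓ)) (Fin (recDim k k₀ ℓ)) ℝ →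
      Matrix (Fin (recDim k k₀ ℓ)) (Fin (recDim n n₀ ℓ)) ℝ →
      Matrix (Fin (recDim m m₀ ℓ)) (Fin (recDim n n₀ ℓ)) ℝ → Prop
  | 0 => fun A B C => ∃ s t q : Fin r₀ → ℝ,
      (∀ i, FlDot ε (base.L i) (rowVec A) (s i)) ∧
      (∀ i, FlDot ε (base.R i) (rowVec B) (t i)) ∧
      (∀ i, FlMul ε (s i) (t i) (q i)) ∧
      ∀ x, FlDot ε (base.P x) q (rowVec C x)
  | ℓ + 1 => fun A B C =>
      ∃ (S : Fin r → Matrix (Fin (recDim m m₀ ℓ)) (Fin (recDim k k₀ ℓ)) ℝ)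
        (T : Fin r → Matrix (Fin (recDim k k₀ ℓ)) (Fin (recDim n n₀ ℓ)) ℝ)
        (Q : Fin r → Matrix (Fin (recDim m m₀ ℓ)) (Fin (recDim n n₀ ℓ)) ℝ),
        (∀ i a b, FlDot ε (alg.L i) (fun x => block A x a b) (S i a b)) ∧
        (∀ i a b, FlDot ε (alg.R i) (fun x => block B x a b) (T i a b)) ∧
        (∀ i, Computed alg base ε ℓ (S i) (T i) (Q i)) ∧
        ∀ x a b, FlDot ε (alg.P x) (fun i => Q i a b) (block C x a b)

/-- `f` is an error bound function of the recursive algorithm for the norms `p` (output) and `q`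
(input): for each number `ℓ` of recursive levels, every computed `C` satisfies
`‖C - A * B‖_p ≤ f ℓ ‖A‖_q ‖B‖_q ε + O(ε ^ 2)`, where the constant in `O(ε ^ 2)` is `D ‖A‖_q ‖B‖_q`
with `D` independent of `A`, `B` and of the rounding errors. -/
def IsErrorBoundFunction (alg : LRP m k n r) (base : LRP m₀ k₀ n₀ r₀) (p q : ℝ≥0∞) (f : ℕ → ℝ) :
    Prop :=
  ∀ ℓ : ℕ, ∃ D : ℝ, ∀ ε : ℝ, 0 ≤ ε → ε ≤ 1 →
    ∀ (A : Matrix (Fin (recDim m m₀ ℓ)) (Fin (recDim k k₀ ℓ)) ℝ)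
      (B : Matrix (Fin (recDim k k₀ ℓ)) (Fin (recDim n n₀ ℓ)) ℝ)
      (C : Matrix (Fin (recDim m m₀ ℓ)) (Fin (recDim n n₀ ℓ)) ℝ),
      alg.Computed base ε ℓ A B C →
        matNorm p (C - A * B) ≤
          f ℓ * matNorm q A * matNorm q B * ε + D * matNorm q A * matNorm q B * ε ^ 2

/-- Whatever the correct bilinear algorithm used at the bottom of the recursion, the recursive
algorithm has an error bound function that is `O(γ_{p,q} ^ ℓ)`, and equivalently
`O((K / k₀) ^ (log_k γ_{p,q}))` and `O(K ^ (log_k γ_{p,q}))`, where `K = k₀ * k ^ ℓ`. -/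
def HasForwardErrorBound (alg : LRP m k n r) (p q : ℝ≥0∞) : Prop :=
  ∀ (m₀ k₀ n₀ r₀ : ℕ) (base : LRP m₀ k₀ n₀ r₀), 0 < m₀ → 0 < k₀ → 0 < n₀ → base.IsMatMul →
    ∃ f : ℕ → ℝ, alg.IsErrorBoundFunction base p q f ∧
      (f =O[atTop] fun ℓ => alg.growthFactor p q ^ ℓ) ∧
      (f =O[atTop] fun ℓ => ((recDim k k₀ ℓ : ℝ) / k₀) ^ alg.errorExponent p q) ∧
      (f =O[atTop] fun ℓ => (recDim k k₀ ℓ : ℝ) ^ alg.errorExponent p q)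

end LRP

/-! ### The new algorithm -/

/-- The matrix `L` of the new algorithm. -/
def newL : Matrix (Fin 48) (Fin 16) ℤ := !![
  -1, -1, -1, 1, -1, -1, -1, 1, -1, -1, -1, 1, 1, 1, 1, -1;
  -1, 1, -1, 1, -1, 1, -1, 1, 1, -1, 1, -1, 1, -1, 1, -1;
  1, 1, -1, -1, -1, -1, 1, 1, -1, -1, 1, 1, -1, -1, 1, 1;
  1, 1, -1, 1, 1, 1, -1, 1, -1, -1, 1, -1, 1, 1, -1, 1;
  -1, 1, 1, 1, -1, 1, 1, 1, 1, -1, -1, -1, 1, -1, -1, -1;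
  1, -1, -1, 1, -1, 1, 1, -1, -1, 1, 1, -1, -1, 1, 1, -1;
  -1, -1, 1, -1, 1, 1, -1, 1, 1, 1, -1, 1, -1, -1, 1, -1;
  1, -1, 1, -1, -1, 1, -1, 1, 1, -1, 1, -1, 1, -1, 1, -1;
  -1, -1, 1, -1, -1, -1, 1, -1, 1, 1, -1, 1, 1, 1, -1, 1;
  1, 1, -1, -1, 1, 1, -1, -1, -1, -1, 1, 1, 1, 1, -1, -1;
  -1, -1, 1, 1, 1, 1, -1, -1, -1, -1, 1, 1, 1, 1, -1, -1;
  -1, 1, 1, 1, 1, -1, -1, -1, 1, -1, -1, -1, -1, 1, 1, 1;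
  1, 1, 1, -1, -1, -1, -1, 1, 1, 1, 1, -1, -1, -1, -1, 1;
  -1, 1, -1, -1, 1, -1, 1, 1, -1, 1, -1, -1, 1, -1, 1, 1;
  -1, -1, 1, 1, -1, -1, 1, 1, 1, 1, -1, -1, 1, 1, -1, -1;
  -1, 1, 1, -1, -1, 1, 1, -1, 1, -1, -1, 1, -1, 1, 1, -1;
  1, -1, 1, 1, 1, -1, 1, 1, -1, 1, -1, -1, 1, -1, 1, 1;
  -1, 1, -1, -1, 1, -1, 1, 1, -1, 1, -1, -1, -1, 1, -1, -1;
  1, 1, 1, 1, 1, 1, 1, 1, 1, 1, 1, 1, 1, 1, 1, 1;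
  1, 1, 1, -1, -1, -1, -1, 1, -1, -1, -1, 1, -1, -1, -1, 1;
  1, -1, -1, 1, 1, -1, -1, 1, 1, -1, -1, 1, 1, -1, -1, 1;
  -1, -1, -1, -1, 1, 1, 1, 1, 1, 1, 1, 1, -1, -1, -1, -1;
  -1, 1, 1, 1, 1, -1, -1, -1, 1, -1, -1, -1, 1, -1, -1, -1;
  1, -1, 1, 1, 1, -1, 1, 1, 1, -1, 1, 1, 1, -1, 1, 1;
  1, 1, 1, 1, -1, -1, -1, -1, 1, 1, 1, 1, 1, 1, 1, 1;
  1, 1, 1, 1, 1, 1, 1, 1, 1, 1, 1, 1, -1, -1, -1, -1;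
  1, 1, 1, -1, 1, 1, 1, -1, 1, 1, 1, -1, 1, 1, 1, -1;
  1, -1, -1, 1, -1, 1, 1, -1, -1, 1, 1, -1, 1, -1, -1, 1;
  1, -1, 1, -1, 1, -1, 1, -1, 1, -1, 1, -1, -1, 1, -1, 1;
  -1, 1, 1, 1, -1, 1, 1, 1, -1, 1, 1, 1, 1, -1, -1, -1;
  1, 1, -1, 1, -1, -1, 1, -1, 1, 1, -1, 1, 1, 1, -1, 1;
  1, -1, 1, -1, -1, 1, -1, 1, 1, -1, 1, -1, -1, 1, -1, 1;
  0, -1, 0, 1, 1, 0, -1, 0, 0, -1, 0, 1, 1, 0, -1, 0;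
  0, 1, 0, -1, -1, 0, -1, 0, 0, -1, 0, 1, -1, 0, -1, 0;
  0, 1, 1, 0, 1, 0, 0, -1, 1, 0, 0, -1, 0, 1, 1, 0;
  0, -1, 1, 0, 1, 0, 0, -1, 1, 0, 0, -1, 0, 1, -1, 0;
  0, 1, 0, 1, 1, 0, 1, 0, 0, 1, 0, 1, 1, 0, 1, 0;
  0, 1, 1, 0, -1, 0, 0, 1, 1, 0, 0, -1, 0, -1, -1, 0;
  0, -1, 1, 0, 1, 0, 0, 1, 1, 0, 0, 1, 0, -1, 1, 0;
  0, 1, 0, 1, 1, 0, -1, 0, 0, -1, 0, -1, 1, 0, -1, 0;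
  0, 1, 0, -1, 1, 0, 1, 0, 0, 1, 0, -1, -1, 0, -1, 0;
  0, 1, -1, 0, 1, 0, 0, 1, -1, 0, 0, -1, 0, -1, 1, 0;
  0, -1, 0, 1, -1, 0, 1, 0, 0, 1, 0, -1, 1, 0, -1, 0;
  0, 1, 0, 1, -1, 0, 1, 0, 0, 1, 0, 1, 1, 0, -1, 0;
  0, 1, 1, 0, -1, 0, 0, -1, 1, 0, 0, 1, 0, 1, 1, 0;
  0, -1, 0, -1, 1, 0, 1, 0, 0, 1, 0, 1, -1, 0, -1, 0;
  0, 1, -1, 0, 1, 0, 0, -1, -1, 0, 0, 1, 0, 1, -1, 0;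
  0, 1, 1, 0, 1, 0, 0, 1, 1, 0, 0, 1, 0, -1, -1, 0]

/-- The matrix `R` of the new algorithm. -/
def newR : Matrix (Fin 48) (Fin 16) ℤ := !![
  0, 0, 0, 0, 0, 1, 1, 0, 0, 0, 0, 0, 0, -1, -1, 0;
  1, 0, 0, 1, 0, 0, 0, 0, 1, 0, 0, 1, 0, 0, 0, 0;
  0, 0, 0, 0, -1, 0, 1, 0, 1, 0, -1, 0, 0, 0, 0, 0;
  0, 0, 0, 0, 0, -1, 1, 0, 0, 0, 0, 0, 0, -1, 1, 0;
  0, 0, 0, 0, 1, 0, 0, 1, 1, 0, 0, 1, 0, 0, 0, 0;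
  1, 0, -1, 0, 0, 0, 0, 0, 0, 0, 0, 0, 1, 0, -1, 0;
  0, 0, 0, 0, 0, -1, 0, 1, 0, 1, 0, -1, 0, 0, 0, 0;
  1, 0, 1, 0, 0, 0, 0, 0, 0, 0, 0, 0, -1, 0, -1, 0;
  1, 0, 0, 1, 0, 0, 0, 0, 0, 0, 0, 0, 1, 0, 0, 1;
  0, 1, -1, 0, 0, 0, 0, 0, 0, 0, 0, 0, 0, -1, 1, 0;
  0, -1, 0, -1, 0, 0, 0, 0, 0, 1, 0, 1, 0, 0, 0, 0;
  0, 1, 0, -1, 0, 0, 0, 0, 0, 0, 0, 0, 0, -1, 0, 1;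
  0, 0, 0, 0, 0, 1, 0, 1, 0, 1, 0, 1, 0, 0, 0, 0;
  0, 1, 0, 1, 0, 0, 0, 0, 0, 0, 0, 0, 0, 1, 0, 1;
  0, 0, 0, 0, -1, 0, 0, -1, 0, 0, 0, 0, 1, 0, 0, 1;
  0, 0, 0, 0, 0, -1, 1, 0, 0, -1, 1, 0, 0, 0, 0, 0;
  0, 1, -1, 0, 0, 0, 0, 0, 0, 1, -1, 0, 0, 0, 0, 0;
  0, 0, 0, 0, -1, 0, -1, 0, 0, 0, 0, 0, 1, 0, 1, 0;
  0, 0, 0, 0, 1, 0, 0, -1, 0, 0, 0, 0, 1, 0, 0, -1;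
  -1, 0, 1, 0, 0, 0, 0, 0, -1, 0, 1, 0, 0, 0, 0, 0;
  1, 0, 0, -1, 0, 0, 0, 0, -1, 0, 0, 1, 0, 0, 0, 0;
  0, 1, 0, -1, 0, 0, 0, 0, 0, 1, 0, -1, 0, 0, 0, 0;
  0, 0, 0, 0, 1, 0, -1, 0, 0, 0, 0, 0, 1, 0, -1, 0;
  0, 0, 0, 0, 1, 0, 0, -1, -1, 0, 0, 1, 0, 0, 0, 0;
  0, 0, 0, 0, 1, 0, 1, 0, 1, 0, 1, 0, 0, 0, 0, 0;
  0, 1, 1, 0, 0, 0, 0, 0, 0, 0, 0, 0, 0, 1, 1, 0;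
  -1, 0, 0, 1, 0, 0, 0, 0, 0, 0, 0, 0, 1, 0, 0, -1;
  0, 0, 0, 0, 0, -1, 0, 1, 0, 0, 0, 0, 0, 1, 0, -1;
  0, 0, 0, 0, 0, -1, -1, 0, 0, 1, 1, 0, 0, 0, 0, 0;
  0, 1, 1, 0, 0, 0, 0, 0, 0, -1, -1, 0, 0, 0, 0, 0;
  1, 0, 1, 0, 0, 0, 0, 0, -1, 0, -1, 0, 0, 0, 0, 0;
  0, 0, 0, 0, 0, 1, 0, 1, 0, 0, 0, 0, 0, 1, 0, 1;
  -1, 1, 0, 2, -1, -1, 0, 0, 1, -1, 0, -2, 1, 1, 0, 0;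
  1, 1, -2, 0, -1, 1, 0, 0, 1, 1, -2, 0, 1, -1, 0, 0;
  1, 1, 0, -2, -1, 1, 0, 0, -1, 1, 0, 0, -1, -1, 0, 2;
  1, 1, 0, 0, -1, 1, 2, 0, 1, -1, -2, 0, -1, -1, 0, 0;
  1, 1, 0, 0, -1, 1, 0, 2, 1, 1, 0, 0, -1, 1, 0, 2;
  1, -1, 0, 0, 1, 1, 0, 2, 1, 1, 0, 2, -1, 1, 0, 0;
  1, -1, 0, 0, 1, 1, 0, -2, -1, -1, 0, 2, 1, -1, 0, 0;
  1, -1, 0, 0, 1, 1, -2, 0, -1, 1, 0, 0, 1, 1, -2, 0;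
  1, -1, 0, 0, 1, 1, 2, 0, 1, -1, 0, 0, -1, -1, -2, 0;
  1, 1, 0, 2, -1, 1, 0, 0, 1, -1, 0, 0, 1, 1, 0, 2;
  -1, -1, 0, 0, 1, -1, 0, 2, 1, 1, 0, 0, -1, 1, 0, -2;
  -1, -1, -2, 0, 1, -1, 0, 0, 1, 1, 2, 0, 1, -1, 0, 0;
  1, 1, 0, 0, -1, 1, -2, 0, -1, 1, -2, 0, 1, 1, 0, 0;
  1, -1, 0, 2, 1, 1, 0, 0, 1, -1, 0, 2, 1, 1, 0, 0;
  1, -1, 2, 0, 1, 1, 0, 0, -1, -1, 0, 0, -1, 1, -2, 0;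
  1, -1, -2, 0, 1, 1, 0, 0, 1, 1, 0, 0, 1, -1, -2, 0]

/-- The matrix `8 P` of the new algorithm. -/
def newP8 : Matrix (Fin 16) (Fin 48) ℤ := !![
  0, -1, 0, 0, 0, 1, 0, 1, -1, 1, 1, 1, 0, 1, 0, 0, -1, 0, 0, -1, 1, -1, 0, 0, 0, 1, -1, 0, 0, 1, 1, 0, 1, -1, -1, 0, 0, 0, 0, 0, 0, -1, 0, 1, 0, -1, 1, 1;
  0, -1, 0, 0, 0, 1, 0, 1, 1, 1, 1, -1, 0, -1, 0, 0, 1, 0, 0, 1, 1, -1, 0, 0, 0, 1, 1, 0, 0, -1, -1, 0, 1, 1, 1, 0, 0, 0, 0, 0, 0, 1, 0, -1, 0, -1, 1, 1;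
  0, -1, 0, 0, 0, -1, 0, 1, -1, -1, -1, -1, 0, 1, 0, 0, -1, 0, 0, 1, -1, -1, 0, 0, 0, 1, 1, 0, 0, -1, 1, 0, -1, 0, 1, -1, 0, 0, 0, -1, 1, -1, 0, 0, -1, -1, 0, 0;
  0, -1, 0, 0, 0, -1, 0, 1, -1, 1, 1, 1, 0, -1, 0, 0, 1, 0, 0, 1, -1, 1, 0, 0, 0, -1, 1, 0, 0, 1, 1, 0, 0, 1, 0, 0, 1, 1, 1, 0, 0, 0, -1, 1, 0, 0, 1, -1;
  1, 0, 1, 1, 1, 0, 1, 0, 0, 0, 0, 0, 1, 0, 1, -1, 0, 1, 1, 0, 0, 0, -1, -1, -1, 0, 0, -1, 1, 0, 0, 1, 0, 0, 0, 1, 1, -1, 1, 1, 1, 0, 1, 0, -1, 0, 0, 0;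
  -1, 0, 1, -1, -1, 0, -1, 0, 0, 0, 0, 0, -1, 0, 1, -1, 0, -1, 1, 0, 0, 0, 1, 1, -1, 0, 0, -1, 1, 0, 0, 1, 0, 0, 0, 1, 1, 1, -1, -1, -1, 0, 1, 0, -1, 0, 0, 0;
  -1, 0, -1, 1, -1, 0, 1, 0, 0, 0, 0, 0, -1, 0, -1, 1, 0, 1, 1, 0, 0, 0, 1, -1, -1, 0, 0, 1, 1, 0, 0, 1, 0, 1, 0, 0, 1, 1, 1, 0, 0, 0, -1, 1, 0, 0, 1, -1;
  -1, 0, 1, 1, 1, 0, 1, 0, 0, 0, 0, 0, -1, 0, 1, 1, 0, -1, -1, 0, 0, 0, -1, 1, 1, 0, 0, 1, 1, 0, 0, 1, 1, 0, -1, 1, 0, 0, 0, 1, -1, 1, 0, 0, 1, 1, 0, 0;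
  0, 1, 1, 0, -1, 0, 1, 0, 0, 0, 1, 0, -1, 0, 0, 1, 1, 0, 0, 1, 1, 1, 0, -1, 1, 0, 0, 0, 1, 1, 1, 0, 1, 1, 0, 1, 0, 1, 1, 0, 0, 0, 0, 1, 1, 1, 0, 0;
  0, 1, 1, 0, 1, 0, -1, 0, 0, 0, 1, 0, 1, 0, 0, 1, -1, 0, 0, -1, 1, 1, 0, 1, 1, 0, 0, 0, 1, -1, -1, 0, 1, -1, 0, 1, 0, -1, -1, 0, 0, 0, 0, -1, 1, 1, 0, 0;
  0, 1, -1, 0, 1, 0, 1, 0, 0, 0, -1, 0, 1, 0, 0, -1, 1, 0, 0, -1, -1, 1, 0, -1, 1, 0, 0, 0, 1, -1, 1, 0, -1, 0, 0, 0, 0, -1, 1, 1, 1, 0, 0, 0, 0, 1, -1, -1;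
  0, 1, 1, 0, -1, 0, 1, 0, 0, 0, 1, 0, 1, 0, 0, -1, -1, 0, 0, -1, -1, -1, 0, 1, -1, 0, 0, 0, 1, 1, 1, 0, 0, -1, -1, 1, 1, 0, 0, 0, 0, -1, 1, 1, -1, 0, 0, 0;
  -1, 0, 0, 1, 0, -1, 0, 1, 1, 1, 0, 1, 0, -1, -1, 0, 0, -1, 1, 0, 0, 0, -1, 0, 0, -1, -1, 1, 0, 0, 0, 1, 0, 0, -1, 0, 1, 0, 0, 1, -1, 1, -1, 0, 0, 0, 1, -1;
  1, 0, 0, -1, 0, -1, 0, 1, -1, 1, 0, -1, 0, 1, -1, 0, 0, 1, 1, 0, 0, 0, 1, 0, 0, -1, 1, 1, 0, 0, 0, 1, 0, 0, 1, 0, 1, 0, 0, -1, 1, -1, -1, 0, 0, 0, 1, -1;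
  1, 0, 0, 1, 0, 1, 0, 1, 1, -1, 0, -1, 0, -1, 1, 0, 0, -1, 1, 0, 0, 0, 1, 0, 0, -1, 1, -1, 0, 0, 0, 1, 0, 1, 1, 1, 1, 0, 0, 0, 0, 1, 1, -1, -1, 0, 0, 0;
  1, 0, 0, 1, 0, 1, 0, 1, 1, 1, 0, 1, 0, 1, -1, 0, 0, 1, -1, 0, 0, 0, -1, 0, 0, 1, 1, -1, 0, 0, 0, 1, 1, 0, 0, 0, 0, -1, 1, 1, 1, 0, 0, 0, 0, -1, 1, 1]

/-- The new algorithm for `4 × 4` matrices with `48` products. -/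
noncomputable def newAlg : LRP 4 4 4 48 where
  L := newL.map fun z : ℤ => (z : ℝ)
  R := newR.map fun z : ℤ => (z : ℝ)
  P := newP8.map fun z : ℤ => (z : ℝ) / 8

/-! ### The algorithms it is compared with -/

/-- Strassen's algorithm (1969). -/
def strassen : LRP 2 2 2 7 where
  L := !![1, 0, 0, 1; 0, 0, 1, 1; 1, 0, 0, 0; 0, 0, 0, 1; 1, 1, 0, 0; -1, 0, 1, 0; 0, 1, 0, -1]
  R := !![1, 0, 0, 1; 1, 0, 0, 0; 0, 1, 0, -1; -1, 0, 1, 0; 0, 0, 0, 1; 1, 1, 0, 0; 0, 0, 1, 1]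
  P := !![1, 0, 0, 1, -1, 0, 1; 0, 0, 1, 0, 1, 0, 0; 0, 1, 0, 1, 0, 0, 0; 1, -1, 1, 0, 0, 1, 0]

/-- Winograd's variant (1977) of Strassen's algorithm. -/
def winograd : LRP 2 2 2 7 where
  L := !![1, 0, 0, 0; 0, 1, 0, 0; 1, 1, -1, -1; 0, 0, 0, 1; 0, 0, 1, 1; -1, 0, 1, 1; 1, 0, -1, 0]
  R := !![1, 0, 0, 0; 0, 0, 1, 0; 0, 0, 0, 1; 1, -1, -1, 1; -1, 1, 0, 0; 1, -1, 0, 1; 0, -1, 0, 1]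
  P := !![1, 1, 0, 0, 0, 0, 0; 1, 0, 1, 0, 1, 1, 0; 1, 0, 0, -1, 0, 1, 1; 1, 0, 0, 0, 1, 1, 1]

/-- The accurate variant of Strassen's algorithm by Dumas, Pernet and Sedoglavic (2024), up to signs
and permutations, which do not change the growth factors. -/
noncomputable def dps24 : LRP 2 2 2 7 where
  L := !![√3 / 2, 1 / 2, -1 / 2, √3 / 2;
    2 * √3 / 3, 0, 0, 0;
    √3 / 3, 1, 0, 0;
    √3 / 3, 0, -1, 0;
    √3 / 6, -1 / 2, -1 / 2, √3 / 2;
    √3 / 6, 1 / 2, 1 / 2, √3 / 2;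
    √3 / 6, -1 / 2, 1 / 2, -√3 / 2]
  R := !![√3 / 2, 1 / 2, -1 / 2, √3 / 2;
    √3 / 2, -1 / 2, -1 / 2, √3 / 6;
    0, 0, -1, √3 / 3;
    0, 1, 0, √3 / 3;
    0, 0, 0, 2 * √3 / 3;
    √3 / 2, 1 / 2, 1 / 2, √3 / 6;
    -√3 / 2, -1 / 2, 1 / 2, √3 / 6]
  P := !![1 / 2, 1 / 2, -1, 0, -1 / 2, 0, -1 / 2;
    √3 / 2, -√3 / 2, 0, 0, -√3 / 2, 0, -√3 / 2;
    -√3 / 2, √3 / 6, √3 / 3, √3 / 3, √3 / 6, 2 * √3 / 3, -√3 / 6;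
    1 / 2, -1 / 2, 0, -1, 1 / 2, 0, -1 / 2]

/-- The matrix `L` of the rational algorithm of 2025. -/
def dps25L : Matrix (Fin 48) (Fin 16) ℤ := !![
  0, 0, 0, 1, 0, 0, 0, 1, 0, 0, 0, 1, 0, 0, 0, -1;
  1, -1, 1, -1, 1, -1, 1, -1, -1, 1, -1, 1, -1, 1, -1, 1;
  1, 1, -1, -1, -1, -1, 1, 1, -1, -1, 1, 1, -1, -1, 1, 1;
  0, 0, 1, 0, 0, 0, 1, 0, 0, 0, -1, 0, 0, 0, 1, 0;
  1, 0, 0, 0, 1, 0, 0, 0, -1, 0, 0, 0, -1, 0, 0, 0;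
  1, -1, -1, 1, -1, 1, 1, -1, -1, 1, 1, -1, -1, 1, 1, -1;
  0, 0, 1, 0, 0, 0, -1, 0, 0, 0, -1, 0, 0, 0, 1, 0;
  1, -1, 1, -1, -1, 1, -1, 1, 1, -1, 1, -1, 1, -1, 1, -1;
  0, 0, 1, 0, 0, 0, 1, 0, 0, 0, -1, 0, 0, 0, -1, 0;
  1, 1, -1, -1, 1, 1, -1, -1, -1, -1, 1, 1, 1, 1, -1, -1;
  1, 1, -1, -1, -1, -1, 1, 1, 1, 1, -1, -1, -1, -1, 1, 1;
  1, 0, 0, 0, -1, 0, 0, 0, -1, 0, 0, 0, 1, 0, 0, 0;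
  0, 0, 0, 1, 0, 0, 0, -1, 0, 0, 0, 1, 0, 0, 0, -1;
  0, 1, 0, 0, 0, -1, 0, 0, 0, 1, 0, 0, 0, -1, 0, 0;
  1, 1, -1, -1, 1, 1, -1, -1, -1, -1, 1, 1, -1, -1, 1, 1;
  1, -1, -1, 1, 1, -1, -1, 1, -1, 1, 1, -1, 1, -1, -1, 1;
  0, 1, 0, 0, 0, 1, 0, 0, 0, -1, 0, 0, 0, 1, 0, 0;
  0, 1, 0, 0, 0, -1, 0, 0, 0, 1, 0, 0, 0, 1, 0, 0;
  1, 1, 1, 1, 1, 1, 1, 1, 1, 1, 1, 1, 1, 1, 1, 1;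
  0, 0, 0, 1, 0, 0, 0, -1, 0, 0, 0, -1, 0, 0, 0, -1;
  1, -1, -1, 1, 1, -1, -1, 1, 1, -1, -1, 1, 1, -1, -1, 1;
  1, 1, 1, 1, -1, -1, -1, -1, -1, -1, -1, -1, 1, 1, 1, 1;
  1, 0, 0, 0, -1, 0, 0, 0, -1, 0, 0, 0, -1, 0, 0, 0;
  0, 1, 0, 0, 0, 1, 0, 0, 0, 1, 0, 0, 0, 1, 0, 0;
  1, 1, 1, 1, -1, -1, -1, -1, 1, 1, 1, 1, 1, 1, 1, 1;
  1, 1, 1, 1, 1, 1, 1, 1, 1, 1, 1, 1, -1, -1, -1, -1;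
  0, 0, 0, 1, 0, 0, 0, 1, 0, 0, 0, 1, 0, 0, 0, 1;
  1, -1, -1, 1, -1, 1, 1, -1, -1, 1, 1, -1, 1, -1, -1, 1;
  1, -1, 1, -1, 1, -1, 1, -1, 1, -1, 1, -1, -1, 1, -1, 1;
  1, 0, 0, 0, 1, 0, 0, 0, 1, 0, 0, 0, -1, 0, 0, 0;
  0, 0, 1, 0, 0, 0, -1, 0, 0, 0, 1, 0, 0, 0, 1, 0;
  1, -1, 1, -1, -1, 1, -1, 1, 1, -1, 1, -1, -1, 1, -1, 1;
  0, 1, 0, -1, -1, 0, 1, 0, 0, 1, 0, -1, -1, 0, 1, 0;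
  0, 1, 0, -1, 0, 1, 0, 1, 0, -1, 0, 1, 0, 1, 0, 1;
  1, 0, 0, 1, -1, 0, 0, 1, -1, 0, 0, 1, 1, 0, 0, 1;
  0, 1, -1, 0, -1, 0, 0, 1, -1, 0, 0, 1, 0, -1, 1, 0;
  1, 0, 1, 0, 0, 1, 0, 1, 1, 0, 1, 0, 0, 1, 0, 1;
  1, 0, 0, 1, 1, 0, 0, -1, -1, 0, 0, 1, -1, 0, 0, -1;
  0, 1, -1, 0, 0, 1, 1, 0, 0, 1, 1, 0, 0, 1, -1, 0;
  1, 0, 1, 0, -1, 0, 1, 0, -1, 0, -1, 0, -1, 0, 1, 0;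
  0, 1, 0, -1, 0, -1, 0, -1, 0, 1, 0, -1, 0, 1, 0, 1;
  0, 1, -1, 0, 0, -1, -1, 0, 0, 1, 1, 0, 0, -1, 1, 0;
  0, 1, 0, -1, 1, 0, -1, 0, 0, -1, 0, 1, -1, 0, 1, 0;
  1, 0, 1, 0, 1, 0, -1, 0, 1, 0, 1, 0, -1, 0, 1, 0;
  1, 0, 0, 1, 0, -1, -1, 0, 0, 1, 1, 0, 1, 0, 0, 1;
  1, 0, 1, 0, 0, -1, 0, -1, -1, 0, -1, 0, 0, 1, 0, 1;
  0, 1, -1, 0, 1, 0, 0, -1, -1, 0, 0, 1, 0, 1, -1, 0;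
  1, 0, 0, 1, 0, 1, 1, 0, 0, 1, 1, 0, -1, 0, 0, -1]

/-- The matrix `R` of the rational algorithm of 2025. -/
def dps25R : Matrix (Fin 48) (Fin 16) ℤ := !![
  0, 0, 0, 0, 1, 1, 0, 1, 0, 0, 0, 0, -1, -1, 0, -1;
  0, 0, 0, 0, 1, 0, 1, 0, 0, 0, 0, 0, 1, 0, 1, 0;
  0, 0, 0, 0, 0, 0, 1, 0, 0, 0, -1, 0, 0, 0, 0, 0;
  0, 0, 0, 1, 0, 0, 0, 0, 0, 0, 0, 1, 0, 0, 0, 0;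
  1, 0, 1, 0, 0, 0, 0, 0, 0, 0, 0, 0, 1, 0, 1, 0;
  0, 0, 0, 0, 0, 0, 1, 0, 0, 0, 1, 0, 0, 0, 0, 0;
  0, 0, 0, 0, 0, 1, 0, 1, 0, -1, 0, -1, 0, 0, 0, 0;
  1, 1, 1, 0, 0, 0, 0, 0, 0, 0, 0, 0, -1, -1, -1, 0;
  0, 0, 0, 0, 1, 0, 1, 0, 1, 0, 1, 0, 0, 0, 0, 0;
  0, 0, 0, 1, 0, 0, 0, 0, 0, 0, 0, 0, 0, 0, 0, -1;
  1, 0, 0, 1, 0, 0, 0, 0, -1, 0, 0, -1, 0, 0, 0, 0;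
  0, 1, 0, 1, 0, 0, 0, 0, 0, 0, 0, 0, 0, -1, 0, -1;
  1, 0, 0, 1, 0, 0, 0, 0, 0, 0, 0, 0, 1, 0, 0, 1;
  0, 0, 0, 0, 1, 0, 0, 1, 1, 0, 0, 1, 0, 0, 0, 0;
  0, 0, 0, 0, 1, 0, 1, 0, 0, 0, 0, 0, -1, 0, -1, 0;
  0, 0, 0, 1, 0, 0, 0, 0, 0, 0, 0, 0, 0, 0, 0, 1;
  0, 0, 0, 0, 0, 0, 0, 1, 0, 0, 0, 0, 0, 0, 0, 1;
  0, 0, 0, 0, 1, 1, 1, 0, 0, 0, 0, 0, -1, -1, -1, 0;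
  0, 1, 1, 0, 0, 0, 0, 0, 0, 1, 1, 0, 0, 0, 0, 0;
  0, 0, 0, 0, 0, 0, 1, 0, 0, 0, 0, 0, 0, 0, 1, 0;
  0, 1, 1, 0, 0, 0, 0, 0, 0, -1, -1, 0, 0, 0, 0, 0;
  0, 0, 0, 0, 0, 1, 0, 1, 0, 0, 0, 0, 0, 1, 0, 1;
  0, 0, 1, 0, 0, 0, 0, 0, 0, 0, 1, 0, 0, 0, 0, 0;
  0, 0, 0, 0, 0, 1, 1, 0, 0, -1, -1, 0, 0, 0, 0, 0;
  1, 1, 1, 0, 0, 0, 0, 0, 0, 0, 0, 0, 1, 1, 1, 0;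
  0, 0, 0, 0, 1, 1, 0, 1, 1, 1, 0, 1, 0, 0, 0, 0;
  0, 1, 1, 0, 0, 0, 0, 0, 0, 0, 0, 0, 0, -1, -1, 0;
  0, 0, 0, 0, 0, 1, 0, 1, 0, 0, 0, 0, 0, -1, 0, -1;
  0, 0, 0, 0, 1, 1, 0, 1, -1, -1, 0, -1, 0, 0, 0, 0;
  1, 1, 0, 1, 0, 0, 0, 0, -1, -1, 0, -1, 0, 0, 0, 0;
  1, 1, 1, 0, 0, 0, 0, 0, -1, -1, -1, 0, 0, 0, 0, 0;
  1, 0, 0, 1, 0, 0, 0, 0, 1, 0, 0, 1, 0, 0, 0, 0;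
  1, -1, -1, 1, -1, -1, -1, -1, -1, 1, 1, -1, 1, 1, 1, 1;
  0, 0, 0, 0, 0, 0, 1, 0, 0, 0, 0, 0, 0, 0, 0, 1;
  0, 1, 1, 0, 0, 0, 0, 0, 0, 0, 0, 0, 0, -1, 0, -1;
  1, 1, 1, 1, 1, 1, -1, 1, -1, -1, 1, -1, -1, -1, -1, -1;
  1, -1, -1, 1, 1, 1, 1, 1, 1, -1, -1, 1, 1, 1, 1, 1;
  1, 0, 0, 1, 0, 0, 0, 0, 0, 0, 0, 0, 1, 0, 1, 0;
  0, 0, 0, 0, 0, 1, 0, 1, 0, -1, -1, 0, 0, 0, 0, 0;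
  0, 0, 0, 1, 0, 0, 0, 0, 0, 0, 1, 0, 0, 0, 0, 0;
  0, 0, 0, 0, 1, 1, 0, 1, 0, 0, 0, 0, -1, -1, -1, 0;
  0, 0, 0, 0, 1, 0, 1, 0, 1, 0, 0, 1, 0, 0, 0, 0;
  1, 1, 1, 1, -1, 1, -1, 1, -1, -1, -1, -1, 1, -1, 1, -1;
  1, 1, 1, 0, 0, 0, 0, 0, -1, -1, 0, -1, 0, 0, 0, 0;
  1, 1, 1, -1, -1, -1, -1, -1, -1, -1, -1, -1, 1, 1, 1, -1;
  1, 1, 1, 1, 1, -1, 1, -1, 1, 1, 1, 1, 1, -1, 1, -1;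
  1, 1, 1, -1, 1, 1, 1, 1, -1, -1, -1, -1, -1, -1, -1, 1;
  1, 1, 1, 1, -1, -1, 1, -1, -1, -1, 1, -1, 1, 1, 1, 1]

/-- The matrix `8 P` of the rational algorithm of 2025. -/
def dps25P8 : Matrix (Fin 16) (Fin 48) ℤ := !![
  0, -2, 0, 0, 0, 2, 0, 2, 4, 0, 0, 0, 0, 0, 0, 0, 0, 0, 0, -4, -2, 0, 0, 0, 0, 0, 4, 0, 0, 0, -4, 0, 1, -2, -2, 1, 1, 2, -2, -2, 2, 2, -1, 2, 1, 1, 1, -1;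
  0, 0, 0, 0, 0, 0, 0, 0, 0, -2, -2, 4, 0, -4, 0, 0, -4, 0, 0, 0, 0, 2, 0, 0, 0, 2, 0, 0, 0, 4, 0, 0, 1, 2, -2, 1, -1, -2, 2, -2, 2, 2, 1, -2, 1, 1, -1, 1;
  0, 0, 0, 0, 0, -2, 0, 0, 0, 2, 2, -4, 0, 0, 0, 0, 0, 0, 0, 4, 2, 0, 0, 0, 0, 0, -4, 0, 0, -4, 0, 0, -2, 2, 4, -1, 0, 0, 0, 2, -2, 0, 0, 2, -1, 0, 1, 1;
  0, 0, 0, 0, 0, -2, 0, 0, -4, 2, 2, 0, 0, 4, 0, 0, 4, 0, 0, 0, 2, 0, 0, 0, 0, 0, 0, 0, 0, 0, 4, 0, -2, -2, 0, -1, 0, 0, 0, 2, -2, -4, 0, -2, -1, 0, 1, 1;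
  -4, 0, 0, -4, 0, 0, -4, 0, 0, 0, 0, 0, -4, 0, 0, -2, 0, 0, 0, 0, 0, 0, 0, 0, 0, 0, 0, -2, -2, 0, 0, -2, -1, -2, 2, -1, 1, 2, -2, 2, -2, -2, -1, 2, -1, -1, 1, -1;
  0, 0, 2, 0, -4, 0, 0, 0, 0, 0, 0, 0, 0, 0, -2, 0, 0, -4, 2, 0, 0, 0, 4, 4, -2, 0, 0, 0, 0, 0, 0, 0, 1, -2, -2, 1, 1, 2, -2, -2, 2, 2, -1, 2, 1, 1, 1, -1;
  4, 0, -2, 0, 4, 0, 0, 0, 0, 0, 0, 0, 4, 0, 2, 2, 0, 0, 0, 0, 0, 0, -4, 0, 0, 0, 0, 2, 0, 0, 0, 0, 0, 2, 0, -1, 0, -4, 0, 2, 2, 0, 2, -2, 1, 0, -1, 1;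
  0, 0, -2, 4, 0, 0, 4, 0, 0, 0, 0, 0, 0, 0, 2, 2, 0, 4, 0, 0, 0, 0, 0, -4, 0, 0, 0, 2, 0, 0, 0, 0, 0, 2, 0, -1, 0, 0, 4, -2, -2, 0, 2, -2, 1, 0, -1, 1;
  0, 2, 0, 0, 0, 0, -4, 0, 0, 0, 0, 0, 4, 0, 0, 2, 0, 0, 0, 4, -2, 0, 0, 0, 0, 0, 0, 0, -2, 0, -4, 0, 1, 2, 2, -1, 1, -2, -2, 2, 2, 2, 1, 2, 1, -1, -1, -1;
  0, 0, 2, 0, 4, 0, 0, 0, 0, 0, -2, 0, 0, 0, 0, 0, 4, 0, 0, 0, 0, -2, 0, 4, 2, 0, 0, 0, 0, 4, 0, 0, 1, -2, -2, 1, -1, -2, -2, 2, 2, -2, -1, -2, -1, -1, -1, -1;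
  0, 0, -2, 0, -4, 0, 0, 0, 0, 0, 2, 0, -4, 0, 0, -2, 0, 0, 0, -4, 2, 0, 0, 0, 0, 0, 0, 0, 0, -4, 0, 0, -2, -2, 0, -1, 0, 4, 0, -2, -2, 0, 0, 2, -1, 0, 1, 1;
  0, 0, -2, 0, 0, 0, 4, 0, 0, 0, 2, 0, 0, 0, 0, -2, -4, 0, 0, 0, 2, 0, 0, -4, 0, 0, 0, 0, 0, 0, 4, 0, -2, 2, 0, -1, 0, 0, 4, -2, -2, 0, 0, -2, -1, 0, 1, 1;
  4, 0, 0, -4, 0, -2, 0, 2, -4, 0, 0, 0, 0, 0, 0, 0, 0, 0, 0, 0, 0, 0, 0, 0, 0, 0, 4, 2, 0, 0, 0, -2, -1, -2, -2, -1, 1, -2, -2, 2, 2, -2, 1, -2, 1, 1, 1, 1;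
  0, 0, 0, 0, 0, 0, 0, 0, 0, -2, 0, 4, 0, 4, 2, 0, 0, 4, 2, 0, 0, 0, 4, 0, 0, -2, 0, 0, 0, 0, 0, 0, 1, -2, -2, -1, 1, 2, 2, -2, -2, -2, 1, -2, 1, -1, -1, -1;
  -4, 0, 0, 0, 0, 2, 0, 0, 0, 2, 0, -4, 0, 0, -2, 0, 0, 0, 0, 0, 0, 0, -4, 0, 0, 0, -4, -2, 0, 0, 0, 0, 0, 2, 4, 1, 0, 0, 0, 2, -2, 0, -2, 2, -1, 0, 1, -1;
  0, 0, 0, 4, 0, 2, 0, 0, 4, 2, 0, 0, 0, -4, -2, 0, 0, -4, 0, 0, 0, 0, 0, 0, 0, 0, 0, -2, 0, 0, 0, 0, 0, 2, 0, 1, 0, 0, 0, -2, 2, 4, -2, 2, -1, 0, 1, -1]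

/-- The rational algorithm for `4 × 4` matrices with `48` products by Dumas, Pernet and Sedoglavic
(2025), in a representation obtained from the new algorithm by an isotropy and normalized so that
`L` and `R` have entries in `{-1, 0, 1}`. Its growth factors for `(p, q) = (∞, ∞)`, `(∞, 2)`,
`(2, ∞)`, `(2, 2)` are the published ones, about `288`, `38.163`, `1032.0`, `139.906`. -/
noncomputable def dps25 : LRP 4 4 4 48 where
  L := dps25L.map fun z : ℤ => (z : ℝ)
  R := dps25R.map fun z : ℤ => (z : ℝ)
  P := dps25P8.map fun z : ℤ => (z : ℝ) / 8

/-! ### Norms of vectors and matrices -/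

/-! The error bound is an induction on the recursion level. Write a level as forming `S i` and `T i`
from the blocks with the rows of `L` and `R`, multiplying them recursively into `Q i`, and combining
with `P`. Hölder's inequality, applied to a row of `L` and the vector of block norms of `A`, bounds
the exact `S i` by the dual norm of the row times `‖A‖_q`; the same holds for `R` and `B`. Summing
the resulting products with weights `|P x i|` gives one entry of the vector that defines the growth
factor, and its `p`-norm gives `γ`, because the norm of a matrix is the norm of its block norms
(`vecNorm_matNorm_block`). So a level multiplies the error inherited from below by `γ` and adds the
roundings of its linear forms, which are relative to the size of the products
(`bilinear_level_error`, `LRP.level_error`).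

If `‖A * B‖_p ≤ κ ρ ^ ℓ ‖A‖_q ‖B‖_q` at level `ℓ`, the first-order coefficient obeys `f (ℓ + 1) = γ
(f ℓ + 3 c κ ρ ^ ℓ)`, where `c` depends on the dimensions only. When `ρ < γ` the solution is `F γ ^
ℓ - G ρ ^ ℓ`, hence `O(γ ^ ℓ)`. The norm inequalities for products give `ρ = 1` for `q = 2`, `ρ = k`
for `(∞, ∞)` and `ρ = k √(m n)` for `(2, ∞)`, all far below the growth factors at hand.

The rest is finite verification. Correctness of an algorithm is a list of polynomial identities
between the entries of `L`, `R`, `P`; for the `4 × 4` algorithms they are packed into 256 integer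
equalities that the kernel evaluates. Growth factors are explicit sums of square roots, and
logarithms are located by comparing integer powers. The four comparisons of exponents share the
separating value `5 / 2`. -/

theorem vecNorm_one {ι : Type} [Fintype ι] (v : ι → ℝ) : vecNorm 1 v = ∑ i, |v i| := by
  simp [vecNorm, PiLp.norm_eq_of_L1]

theorem vecNorm_two {ι : Type} [Fintype ι] (v : ι → ℝ) : vecNorm 2 v = √(∑ i, v i ^ 2) := by
  simp [vecNorm, PiLp.norm_eq_of_L2]

theorem vecNorm_top {ι : Type} [Fintype ι] (v : ι → ℝ) : vecNorm ∞ v = ‖v‖ := by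
  simp [vecNorm]

theorem vecNorm_top_le_iff {ι : Type} [Fintype ι] {v : ι → ℝ} {c : ℝ} (hc : 0 ≤ c) :
    vecNorm ∞ v ≤ c ↔ ∀ i, |v i| ≤ c := by
  rw [vecNorm_top, pi_norm_le_iff_of_nonneg hc]; simp

theorem abs_le_vecNorm_top {ι : Type} [Fintype ι] (v : ι → ℝ) (i : ι) : |v i| ≤ vecNorm ∞ v := by
  rw [vecNorm_top]; simpa using norm_le_pi_norm v i

theorem conjExponent_two : ENNReal.conjExponent 2 = 2 := by
  have : (2 : ℝ≥0∞) - 1 = 1 := by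
    rw [show (2 : ℝ≥0∞) = 1 + 1 by norm_num]; exact ENNReal.add_sub_cancel_right (by simp)
  rw [ENNReal.conjExponent, this, inv_one]; norm_num

theorem conjExponent_top : ENNReal.conjExponent ∞ = 1 := by
  simp [ENNReal.conjExponent]

/-- The `p`-norm of vectors as a seminorm. -/
noncomputable def vecSeminorm (p : ℝ≥0∞) [Fact (1 ≤ p)] (ι : Type) [Fintype ι] :
    Seminorm ℝ (ι → ℝ) :=
  (normSeminorm ℝ (WithLp p (ι → ℝ))).comp (WithLp.linearEquiv p ℝ (ι → ℝ)).symm.toLinearMap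

theorem vecSeminorm_apply (p : ℝ≥0∞) [Fact (1 ≤ p)] {ι : Type} [Fintype ι] (v : ι → ℝ) :
    vecSeminorm p ι v = vecNorm p v := rfl

/-- The coefficientwise `p`-norm of matrices as a seminorm. -/
noncomputable def matSeminorm (p : ℝ≥0∞) [Fact (1 ≤ p)] (m k : ℕ) :
    Seminorm ℝ (Matrix (Fin m) (Fin k) ℝ) :=
  (vecSeminorm p (Fin (m * k))).comp
    ({ toFun := rowVec, map_add' := fun _ _ => rfl, map_smul' := fun _ _ => rfl } :
      Matrix (Fin m) (Fin k) ℝ →ₗ[ℝ] Fin (m * k) → ℝ)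

theorem matSeminorm_apply (p : ℝ≥0∞) [Fact (1 ≤ p)] {m k : ℕ} (A : Matrix (Fin m) (Fin k) ℝ) :
    matSeminorm p m k A = matNorm p A := rfl

theorem matNorm_nonneg {p : ℝ≥0∞} [Fact (1 ≤ p)] {m k : ℕ} (A : Matrix (Fin m) (Fin k) ℝ) :
    0 ≤ matNorm p A := by
  rw [← matSeminorm_apply]; exact apply_nonneg _ _

theorem vecNorm_nonneg {p : ℝ≥0∞} [Fact (1 ≤ p)] {ι : Type} [Fintype ι] (v : ι → ℝ) :
    0 ≤ vecNorm p v := by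
  rw [← vecSeminorm_apply]; exact apply_nonneg _ _

theorem Seminorm.sum_smul_le {E ι : Type*} [AddCommGroup E] [Module ℝ E] (N : Seminorm ℝ E)
    (s : Finset ι) (c : ι → ℝ) (Y : ι → E) :
    N (∑ x ∈ s, c x • Y x) ≤ ∑ x ∈ s, |c x| * N (Y x) := by
  refine (Finset.le_sum_of_subadditive N (map_zero N).le (map_add_le_add N) s _).trans (Finset.sum_le_sum fun x _ => ?_)
  rw [map_smul_eq_mul, Real.norm_eq_abs]

theorem vecNorm_mono {p : ℝ≥0∞} (hp : p = 2 ∨ p = ∞) {ι : Type} [Fintype ι] {v w : ι → ℝ}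
    (h : ∀ i, |v i| ≤ w i) : vecNorm p v ≤ vecNorm p w := by
  have h' : ∀ i, |v i| ≤ |w i| := fun i => (h i).trans (le_abs_self _)
  rcases hp with rfl | rfl
  · rw [vecNorm_two, vecNorm_two]
    exact Real.sqrt_le_sqrt (Finset.sum_le_sum fun i _ => sq_le_sq.2 (h' i))
  · exact (vecNorm_top_le_iff (vecNorm_nonneg _)).2 fun i => (h' i).trans (abs_le_vecNorm_top w i)

theorem vecNorm_mul_right {p : ℝ≥0∞} [Fact (1 ≤ p)] {ι : Type} [Fintype ι] (v : ι → ℝ) {c : ℝ}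
    (hc : 0 ≤ c) : vecNorm p (fun i => v i * c) = vecNorm p v * c := by
  have : (fun i => v i * c) = c • v := by ext i; simp [mul_comm]
  rw [this, ← vecSeminorm_apply, map_smul_eq_mul, Real.norm_of_nonneg hc, mul_comm]; rfl

/-- Hölder's inequality for the exponents `2` and `∞`. -/
theorem sum_abs_mul_abs_le {q : ℝ≥0∞} (hq : q = 2 ∨ q = ∞) {ι : Type} [Fintype ι] (u v : ι → ℝ) :
    ∑ i, |u i| * |v i| ≤ vecNorm q.conjExponent u * vecNorm q v := by
  rcases hq with rfl | rfl
  · rw [conjExponent_two, vecNorm_two, vecNorm_two]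
    simpa using Real.sum_mul_le_sqrt_mul_sqrt Finset.univ (fun i => |u i|) (fun i => |v i|)
  · rw [conjExponent_top, vecNorm_one, Finset.sum_mul]
    exact Finset.sum_le_sum fun i _ =>
      mul_le_mul_of_nonneg_left (abs_le_vecNorm_top v i) (abs_nonneg _)

theorem sum_finProd {m k : ℕ} (g : Fin (m * k) → ℝ) :
    ∑ x, g x = ∑ i, ∑ j, g (finProdFinEquiv (i, j)) := by
  rw [← Fintype.sum_prod_type', ← Equiv.sum_comp finProdFinEquiv]

theorem rowVec_apply {m k : ℕ} (A : Matrix (Fin m) (Fin k) ℝ) (i : Fin m) (j : Fin k) :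
    rowVec A (finProdFinEquiv (i, j)) = A i j := by
  simp [rowVec]

theorem forall_finProd {m k : ℕ} {φ : Fin (m * k) → Prop} :
    (∀ x, φ x) ↔ ∀ i j, φ (finProdFinEquiv (i, j)) := by
  rw [← Prod.forall' (p := fun i j => φ (finProdFinEquiv (i, j)))]
  exact (Equiv.forall_congr_right finProdFinEquiv).symm

theorem matNorm_two {m k : ℕ} (A : Matrix (Fin m) (Fin k) ℝ) :
    matNorm 2 A = √(∑ i, ∑ j, A i j ^ 2) := by
  rw [matNorm, vecNorm_two, sum_finProd]; simp only [rowVec_apply]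

theorem matNorm_top_le_iff {m k : ℕ} {A : Matrix (Fin m) (Fin k) ℝ} {c : ℝ} (hc : 0 ≤ c) :
    matNorm ∞ A ≤ c ↔ ∀ i j, |A i j| ≤ c := by
  rw [matNorm, vecNorm_top_le_iff hc, forall_finProd]; simp only [rowVec_apply]

theorem abs_le_matNorm_top {m k : ℕ} (A : Matrix (Fin m) (Fin k) ℝ) (i : Fin m) (j : Fin k) :
    |A i j| ≤ matNorm ∞ A :=
  (matNorm_top_le_iff (matNorm_nonneg A)).1 le_rfl i j

theorem block_apply {m k M K : ℕ} (A : Matrix (Fin (m * M)) (Fin (k * K)) ℝ)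
    (i : Fin m) (j : Fin k) (a : Fin M) (b : Fin K) :
    block A (finProdFinEquiv (i, j)) a b = A (finProdFinEquiv (i, a)) (finProdFinEquiv (j, b)) := by
  simp [block]

/-- The norm of a matrix is the norm of the vector of the norms of its blocks. -/
theorem vecNorm_matNorm_block {p : ℝ≥0∞} (hp : p = 2 ∨ p = ∞) {m k M K : ℕ}
    (A : Matrix (Fin (m * M)) (Fin (k * K)) ℝ) :
    vecNorm p (fun x => matNorm p (block A x)) = matNorm p A := by
  rcases hp with rfl | rfl
  · rw [vecNorm_two, matNorm_two, sum_finProd, sum_finProd]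
    congr 1
    refine Finset.sum_congr rfl fun i _ => ?_
    have h : ∀ j, matNorm 2 (block A (finProdFinEquiv (i, j))) ^ 2 =
        ∑ a, ∑ b, A (finProdFinEquiv (i, a)) (finProdFinEquiv (j, b)) ^ 2 := fun j => by
      rw [matNorm_two, Real.sq_sqrt (by positivity)]; simp only [block_apply]
    simp only [h, sum_finProd]
    exact Finset.sum_comm
  · apply le_antisymm
    · rw [vecNorm_top_le_iff (matNorm_nonneg A)]
      intro x
      rw [abs_of_nonneg (matNorm_nonneg _), matNorm_top_le_iff (matNorm_nonneg A)]
      exact fun a b => abs_le_matNorm_top A _ _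
    · rw [matNorm_top_le_iff (vecNorm_nonneg _), forall_finProd]
      intro i a
      rw [forall_finProd]
      intro j b
      rw [← block_apply A i j a b]
      exact (abs_le_matNorm_top _ _ _).trans ((le_abs_self _).trans
        (abs_le_vecNorm_top (fun x => matNorm ∞ (block A x)) (finProdFinEquiv (i, j))))

/-- A matrix that is dominated by a combination of matrices is also dominated in norm. -/
theorem matNorm_le_of_abs_le {p : ℝ≥0∞} [Fact (1 ≤ p)] (hp : p = 2 ∨ p = ∞) {m k : ℕ} {ι : Type}
    [Fintype ι] {X : Matrix (Fin m) (Fin k) ℝ} {Y : ι → Matrix (Fin m) (Fin k) ℝ} {c : ι → ℝ}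
    {u : ℝ} (hu : 0 ≤ u) (h : ∀ a b, |X a b| ≤ u * ∑ x, |c x| * |Y x a b|) :
    matNorm p X ≤ u * ∑ x, |c x| * matNorm p (Y x) := by
  -- The comparison matrix uses the entrywise absolute values of the `Y x`. These have the same norm
  -- as the `Y x`, so the triangle inequality loses nothing through cancellation of signs.
  have h1 : matNorm p X ≤ matNorm p (∑ x, (u * |c x|) • (Y x).map (|·|)) := by
    refine vecNorm_mono hp fun y => (h _ _).trans_eq ?_
    rw [rowVec, Matrix.sum_apply, Finset.mul_sum]
    exact Finset.sum_congr rfl fun x _ => by simp [mul_assoc]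
  have h2 : ∀ x, matNorm p ((Y x).map (|·|)) ≤ matNorm p (Y x) := fun x => by
    rcases hp with rfl | rfl
    · rw [matNorm_two, matNorm_two]; simp
    · rw [matNorm_top_le_iff (matNorm_nonneg _)]
      intro i j
      simpa using abs_le_matNorm_top (Y x) i j
  refine h1.trans ?_
  rw [← matSeminorm_apply, Finset.mul_sum]
  refine (Seminorm.sum_smul_le _ _ _ _).trans (Finset.sum_le_sum fun x _ => ?_)
  rw [abs_of_nonneg (by positivity), mul_assoc, matSeminorm_apply]
  exact mul_le_mul_of_nonneg_left (mul_le_mul_of_nonneg_left (h2 x) (abs_nonneg _)) hu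

/-! ### Rounded linear forms -/

/-- A summand is multiplied by one factor `1 + δ` for each addition above it in the summation tree,
and a tree with `N` leaves has `N - 1` additions. This depends neither on the order nor on the
parenthesization. -/
theorem FlSum.error {ε : ℝ} (hε : 0 ≤ ε) {s : Multiset ℝ} {z : ℝ} (h : FlSum ε s z) :
    ∃ d : ℕ, d + 1 ≤ s.card ∧ |z - s.sum| ≤ ((1 + ε) ^ d - 1) * (s.map (|·|)).sum := by
  induction h with
  | single x => exact ⟨0, by simp⟩
  | add s t x y δ hδ _ _ ihx ihy =>
    obtain ⟨d, hd, hx⟩ := ihx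
    obtain ⟨e, he, hy⟩ := ihy
    -- The sum `d + e` is a convenient upper bound for the larger of the two depths. It still leaves
    -- room for the present addition, since the cardinality of `s + t` is at least `d + e + 2`.
    refine ⟨d + e + 1, by rw [Multiset.card_add]; omega, ?_⟩
    rw [Multiset.sum_add, Multiset.map_add, Multiset.sum_add]
    set σ := s.sum
    set τ := t.sum
    set σ' := (s.map (|·|)).sum
    set τ' := (t.map (|·|)).sum
    have hσ : |σ| ≤ σ' := Multiset.abs_sum_le_sum_abs
    have hτ : |τ| ≤ τ' := Multiset.abs_sum_le_sum_abs
    have hσ0 := (abs_nonneg σ).trans hσ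
    have hτ0 := (abs_nonneg τ).trans hτ
    have h1 : (1 : ℝ) ≤ 1 + ε := by linarith
    have hdm : (1 + ε) ^ d ≤ (1 + ε) ^ (d + e) := pow_le_pow_right₀ h1 (by omega)
    have hem : (1 + ε) ^ e ≤ (1 + ε) ^ (d + e) := pow_le_pow_right₀ h1 (by omega)
    set u := (1 + ε) ^ (d + e)
    have hu : 1 ≤ u := one_le_pow₀ h1
    have hx' : |x - σ| ≤ (u - 1) * σ' :=
      hx.trans (mul_le_mul_of_nonneg_right (by linarith) hσ0)
    have hy' : |y - τ| ≤ (u - 1) * τ' :=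
      hy.trans (mul_le_mul_of_nonneg_right (by linarith) hτ0)
    have hxy : |(x - σ) + (y - τ)| ≤ (u - 1) * (σ' + τ') :=
      (abs_add_le _ _).trans (by linarith)
    have hst : |σ + τ| ≤ σ' + τ' := (abs_add_le _ _).trans (by linarith)
    -- The inherited errors are amplified by `1 + δ`, while the new rounding acts on the exact sum.
    have e1 : (x + y) * (1 + δ) - (σ + τ)
        = ((x - σ) + (y - τ)) * (1 + δ) + (σ + τ) * δ := by ring
    have hd1 : |1 + δ| ≤ 1 + ε := (abs_add_le _ _).trans (by simpa using hδ)
    calc |(x + y) * (1 + δ) - (σ + τ)|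
        ≤ |(x - σ) + (y - τ)| * |1 + δ| + |σ + τ| * |δ| := by
          rw [e1, ← abs_mul, ← abs_mul]; exact abs_add_le _ _
      _ ≤ (u - 1) * (σ' + τ') * (1 + ε) + (σ' + τ') * ε := by
          gcongr
      _ = ((1 + ε) ^ (d + e + 1) - 1) * (σ' + τ') := by rw [pow_succ]; ring

/-- By convexity in `ε`, the left side lies below its chord on `[0, 1]`. This is where `ε ≤ 1` is
used to linearize accumulated roundings. -/
theorem one_add_pow_sub_one_le {ε : ℝ} (hε : 0 ≤ ε) (hε1 : ε ≤ 1) (n : ℕ) :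
    (1 + ε) ^ n - 1 ≤ (2 ^ n - 1) * ε := by
  induction n with
  | zero => simp
  | succ n ih =>
    have h2 : (1 : ℝ) ≤ 2 ^ n := one_le_pow₀ (by norm_num)
    rw [pow_succ, pow_succ]
    nlinarith [mul_nonneg (mul_nonneg (sub_nonneg.2 h2) hε) (sub_nonneg.2 hε1)]

/-- The rounded multiplication adds one factor `1 + ε` to the at most `n - 1` factors of the
additions. The constant `2 ^ n` is crude, but it only affects the constant in front of `γ ^ ℓ`,
never the growth rate. -/
theorem FlDot.error {ε : ℝ} (hε : 0 ≤ ε) (hε1 : ε ≤ 1) {n : ℕ} {c v : Fin n → ℝ} {z : ℝ}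
    (h : FlDot ε c v z) : |z - ∑ x, c x * v x| ≤ 2 ^ n * ε * ∑ x, |c x| * |v x| := by
  obtain ⟨t, ht, hz⟩ := h
  obtain ⟨d, hd, hz⟩ := hz.error hε
  rw [Multiset.map_map] at hz
  have hd' : d + 1 ≤ n := by simpa using hd
  change |z - ∑ x, t x| ≤ ((1 + ε) ^ d - 1) * ∑ x, |t x| at hz
  have hδ : ∀ x, |t x - c x * v x| ≤ ε * (|c x| * |v x|) := fun x => by
    obtain ⟨δ, hδ, e⟩ := ht x
    rw [e, show c x * v x * (1 + δ) - c x * v x = δ * (c x * v x) by ring, abs_mul, abs_mul (c x)]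
    gcongr
  have ht' : ∀ x, |t x| ≤ (1 + ε) * (|c x| * |v x|) := fun x => by
    have := abs_add_le (t x - c x * v x) (c x * v x)
    rw [sub_add_cancel, abs_mul (c x)] at this
    linarith [hδ x]
  set σ := ∑ x, |c x| * |v x| with hσ
  have hσ0 : 0 ≤ σ := Finset.sum_nonneg fun x _ => by positivity
  have h1 : ∑ x, |t x| ≤ (1 + ε) * σ := by
    rw [hσ, Finset.mul_sum]; exact Finset.sum_le_sum fun x _ => ht' x
  have h2 : |∑ x, t x - ∑ x, c x * v x| ≤ ε * σ := by
    rw [hσ, Finset.mul_sum, ← Finset.sum_sub_distrib]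
    exact (Finset.abs_sum_le_sum_abs _ _).trans (Finset.sum_le_sum fun x _ => hδ x)
  have hu : (1 : ℝ) ≤ (1 + ε) ^ d := one_le_pow₀ (by linarith)
  calc |z - ∑ x, c x * v x| ≤ |z - ∑ x, t x| + |∑ x, t x - ∑ x, c x * v x| := abs_sub_le _ _ _
    _ ≤ ((1 + ε) ^ d - 1) * ((1 + ε) * σ) + ε * σ := by
        gcongr
        exact hz.trans (mul_le_mul_of_nonneg_left h1 (by linarith))
    _ = ((1 + ε) ^ (d + 1) - 1) * σ := by rw [pow_succ]; ring
    _ ≤ ((1 + ε) ^ n - 1) * σ := by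
        gcongr
        linarith
    _ ≤ (2 ^ n - 1) * ε * σ := by
        gcongr
        exact one_add_pow_sub_one_le hε hε1 n
    _ ≤ 2 ^ n * ε * σ := by
        gcongr
        linarith

/-! ### One level of a bilinear algorithm in rounded arithmetic -/

/-- Propagation of errors through one level of a bilinear algorithm. -/
theorem bilinear_level_error {E F G : Type*} [AddCommGroup E] [Module ℝ E] [AddCommGroup F]
    [Module ℝ F] [AddCommGroup G] [Module ℝ G] (NE : Seminorm ℝ E) (NF : Seminorm ℝ F)
    (NG : Seminorm ℝ G) (μ : E →ₗ[ℝ] F →ₗ[ℝ] G) {κ : ℝ} (hκ : 0 ≤ κ)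
    (hμ : ∀ x y, NG (μ x y) ≤ κ * NE x * NF y) {r : ℕ} (w : Fin r → ℝ) {S S' : Fin r → E}
    {T T' : Fin r → F} {Q : Fin r → G} {C : G} {σ τ : Fin r → ℝ} {u g : ℝ} (hu : 0 ≤ u)
    (hg : 0 ≤ g) (hS : ∀ i, NE (S i) ≤ σ i) (hT : ∀ i, NF (T i) ≤ τ i)
    (hS' : ∀ i, NE (S' i - S i) ≤ u * σ i) (hT' : ∀ i, NF (T' i - T i) ≤ u * τ i)
    (hQ : ∀ i, NG (Q i - μ (S' i) (T' i)) ≤ g * NE (S' i) * NF (T' i))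
    (hC : NG (C - ∑ i, w i • Q i) ≤ u * ∑ i, |w i| * NG (Q i)) :
    NG (C - ∑ i, w i • μ (S i) (T i)) ≤
      (∑ i, σ i * τ i * |w i|) * (g * (1 + u) ^ 3 + κ * ((1 + u) ^ 3 - 1)) := by
  have hσ : ∀ i, 0 ≤ σ i := fun i => (apply_nonneg NE _).trans (hS i)
  have hτ : ∀ i, 0 ≤ τ i := fun i => (apply_nonneg NF _).trans (hT i)
  have hSn : ∀ i, NE (S' i) ≤ (1 + u) * σ i := fun i => by
    have := map_add_le_add NE (S' i - S i) (S i)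
    rw [sub_add_cancel] at this
    linarith [hS i, hS' i]
  have hTn : ∀ i, NF (T' i) ≤ (1 + u) * τ i := fun i => by
    have := map_add_le_add NF (T' i - T i) (T i)
    rw [sub_add_cancel] at this
    linarith [hT i, hT' i]
  -- This is `g (1 + u) ^ 2 + κ ((1 + u) ^ 2 - 1)`: the error of the recursive product on perturbed
  -- factors, plus the effect of perturbing both factors of `μ`.
  set h := g * (1 + u) ^ 2 + κ * (2 * u + u ^ 2) with hh
  have hQe : ∀ i, NG (Q i - μ (S i) (T i)) ≤ h * (σ i * τ i) := fun i => by
    have e : Q i - μ (S i) (T i) = (Q i - μ (S' i) (T' i)) +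
        (μ (S' i - S i) (T' i) + μ (S i) (T' i - T i)) := by
      simp only [map_sub, LinearMap.sub_apply]; abel
    have a1 : g * NE (S' i) * NF (T' i) ≤ g * ((1 + u) * σ i) * ((1 + u) * τ i) := by
      gcongr
      · exact mul_nonneg hg (mul_nonneg (by linarith) (hσ i))
      · exact hSn i
      · exact hTn i
    have a2 : NG (μ (S' i - S i) (T' i)) ≤ κ * (u * σ i) * ((1 + u) * τ i) :=
      (hμ _ _).trans (by
        gcongr
        · exact mul_nonneg hκ (mul_nonneg hu (hσ i))
        · exact hS' i
        · exact hTn i)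
    have a3 : NG (μ (S i) (T' i - T i)) ≤ κ * σ i * (u * τ i) :=
      (hμ _ _).trans (by
        gcongr
        · exact mul_nonneg hκ (hσ i)
        · exact hS i
        · exact hT' i)
    have b1 := map_add_le_add NG (Q i - μ (S' i) (T' i))
      (μ (S' i - S i) (T' i) + μ (S i) (T' i - T i))
    have b2 := map_add_le_add NG (μ (S' i - S i) (T' i)) (μ (S i) (T' i - T i))
    rw [← e] at b1
    have : h * (σ i * τ i) = g * ((1 + u) * σ i) * ((1 + u) * τ i) +
        κ * (u * σ i) * ((1 + u) * τ i) + κ * σ i * (u * τ i) := by rw [hh]; ring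
    linarith [hQ i]
  have hQn : ∀ i, NG (Q i) ≤ (h + κ) * (σ i * τ i) := fun i => by
    have b := map_add_le_add NG (Q i - μ (S i) (T i)) (μ (S i) (T i))
    rw [sub_add_cancel] at b
    have : NG (μ (S i) (T i)) ≤ κ * σ i * τ i :=
      (hμ _ _).trans (by
        gcongr
        · exact mul_nonneg hκ (hσ i)
        · exact hS i
        · exact hT i)
    linarith [hQe i]
  have e : C - ∑ i, w i • μ (S i) (T i) = (C - ∑ i, w i • Q i) +
      ∑ i, w i • (Q i - μ (S i) (T i)) := by
    simp only [smul_sub, Finset.sum_sub_distrib]; abel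
  have c1 : ∑ i, |w i| * NG (Q i) ≤ (h + κ) * ∑ i, σ i * τ i * |w i| := by
    rw [Finset.mul_sum]
    refine Finset.sum_le_sum fun i _ => ?_
    linarith [mul_le_mul_of_nonneg_left (hQn i) (abs_nonneg (w i))]
  have c2 : ∑ i, |w i| * NG (Q i - μ (S i) (T i)) ≤ h * ∑ i, σ i * τ i * |w i| := by
    rw [Finset.mul_sum]
    refine Finset.sum_le_sum fun i _ => ?_
    linarith [mul_le_mul_of_nonneg_left (hQe i) (abs_nonneg (w i))]
  have b := map_add_le_add NG (C - ∑ i, w i • Q i) (∑ i, w i • (Q i - μ (S i) (T i)))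
  rw [← e] at b
  have c3 := Seminorm.sum_smul_le NG Finset.univ w fun i => Q i - μ (S i) (T i)
  have c4 := mul_le_mul_of_nonneg_left c1 hu
  -- Since `h + κ = (g + κ) (1 + u) ^ 2`, the total `u (h + κ) + h` equals `(g + κ) (1 + u) ^ 3 -
  -- κ`: one factor `1 + u` for each of the three families of linear forms.
  have : (∑ i, σ i * τ i * |w i|) * (g * (1 + u) ^ 3 + κ * ((1 + u) ^ 3 - 1)) =
      u * ((h + κ) * ∑ i, σ i * τ i * |w i|) + h * ∑ i, σ i * τ i * |w i| := by rw [hh]; ring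
  linarith

/-- The first-order part of the error after one level. -/
theorem level_error_le {c κ f D ε : ℝ} (hc : 0 ≤ c) (hκ : 0 ≤ κ) (hf : 0 ≤ f) (hD : 0 ≤ D)
    (hε : 0 ≤ ε) (hε1 : ε ≤ 1) :
    (f * ε + D * ε ^ 2) * (1 + c * ε) ^ 3 + κ * ((1 + c * ε) ^ 3 - 1) ≤
      (f + 3 * c * κ) * ε +
        (f * (3 * c + 3 * c ^ 2 + c ^ 3) + D * (1 + c) ^ 3 + κ * (3 * c ^ 2 + c ^ 3)) * ε ^ 2 := by
  have h2 : ε ^ 2 ≤ 1 := pow_le_one₀ hε hε1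
  -- For `ε ≤ 1` every higher power is absorbed into `ε ^ 2`, which keeps the remainder constant
  -- independent of `ε`.
  have h3 : ε ^ 3 ≤ ε ^ 2 := pow_le_pow_of_le_one hε hε1 (by norm_num)
  have h4 : ε ^ 4 ≤ ε ^ 2 := pow_le_pow_of_le_one hε hε1 (by norm_num)
  have a1 : (1 + c * ε) ^ 3 ≤ (1 + c) ^ 3 := by
    gcongr
    nlinarith
  have t1 := mul_le_mul_of_nonneg_left a1 (by positivity : 0 ≤ D * ε ^ 2)
  have t2 := mul_le_mul_of_nonneg_left h3 (by positivity : 0 ≤ f * (3 * c ^ 2))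
  have t3 := mul_le_mul_of_nonneg_left h4 (by positivity : 0 ≤ f * c ^ 3)
  have t4 := mul_le_mul_of_nonneg_left h3 (by positivity : 0 ≤ κ * c ^ 3)
  linarith

theorem recDim_cast (k k₀ ℓ : ℕ) : (recDim k k₀ ℓ : ℝ) = k₀ * (k : ℝ) ^ ℓ := by
  induction ℓ with
  | zero => simp [recDim]
  | succ ℓ ih => rw [recDim, Nat.cast_mul, ih, pow_succ]; ring

/-- The product of matrices as a bilinear map. -/
def matMulBilin (M K N : ℕ) : Matrix (Fin M) (Fin K) ℝ →ₗ[ℝ] Matrix (Fin K) (Fin N) ℝ →ₗ[ℝ]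
    Matrix (Fin M) (Fin N) ℝ :=
  LinearMap.mk₂ ℝ (fun X Y => X * Y) Matrix.add_mul (fun _ _ _ => Matrix.smul_mul _ _ _)
    Matrix.mul_add (fun _ _ _ => Matrix.mul_smul _ _ _)

/-- The bound `u` is kept separate from `2 ^ n * ε` so that one value serves the linear forms of
`L`, `R` and `P`, whose lengths differ. -/
theorem matNorm_sub_sum_le {p : ℝ≥0∞} [Fact (1 ≤ p)] (hp : p = 2 ∨ p = ∞) {M N n : ℕ} {ε u : ℝ}
    (hε : 0 ≤ ε) (hε1 : ε ≤ 1) (hu : 2 ^ n * ε ≤ u) {c : Fin n → ℝ}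
    {Y : Fin n → Matrix (Fin M) (Fin N) ℝ} {X : Matrix (Fin M) (Fin N) ℝ}
    (h : ∀ a b, FlDot ε c (fun x => Y x a b) (X a b)) :
    matNorm p (X - ∑ x, c x • Y x) ≤ u * ∑ x, |c x| * matNorm p (Y x) := by
  refine matNorm_le_of_abs_le hp ((by positivity : 0 ≤ 2 ^ n * ε).trans hu) fun a b => ?_
  rw [Matrix.sub_apply, Matrix.sum_apply]
  exact ((h a b).error hε hε1).trans
    (mul_le_mul_of_nonneg_right hu (Finset.sum_nonneg fun _ _ => by positivity))

namespace LRP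

variable {m k n r m₀ k₀ n₀ r₀ : ℕ}

/-- A matrix multiplication algorithm over the reals can be applied to matrices cut into blocks. -/
theorem IsMatMul.block_mul {alg : LRP m k n r} (h : alg.IsMatMul) {M K N : ℕ}
    (A : Matrix (Fin (m * M)) (Fin (k * K)) ℝ) (B : Matrix (Fin (k * K)) (Fin (n * N)) ℝ)
    (x : Fin (m * n)) :
    block (A * B) x =
      ∑ i, alg.P x i • ((∑ y, alg.L i y • block A y) * ∑ z, alg.R i z • block B z) := by
  ext a b
  -- Blocks do not commute, so the scalar identity is applied to slices: fixing the position `(a,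
  -- c)` inside the blocks of `A` and `(c, b)` inside those of `B` leaves small real matrices. Entry
  -- `(a, b)` of a block of `A * B` is the sum over `c` of the products of these slices.
  let A' : Fin K → Matrix (Fin m) (Fin k) ℝ := fun c i j =>
    A (finProdFinEquiv (i, a)) (finProdFinEquiv (j, c))
  let B' : Fin K → Matrix (Fin k) (Fin n) ℝ := fun c i j =>
    B (finProdFinEquiv (i, c)) (finProdFinEquiv (j, b))
  have hc : ∀ c, rowVec (A' c * B' c) x =
      ∑ i, alg.P x i * ((∑ y, alg.L i y * block A y a c) * ∑ z, alg.R i z * block B z c b) :=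
    fun c => by rw [← h (A' c) (B' c)]; rfl
  have hl : block (A * B) x a b = ∑ c, rowVec (A' c * B' c) x := by
    simp only [block, rowVec, Matrix.mul_apply, sum_finProd, A', B']
    exact Finset.sum_comm
  rw [hl]
  simp only [hc]
  rw [Finset.sum_comm, Matrix.sum_apply]
  refine Finset.sum_congr rfl fun i _ => ?_
  rw [Matrix.smul_apply, Matrix.mul_apply, smul_eq_mul, Finset.mul_sum]
  simp only [Matrix.sum_apply, Matrix.smul_apply, smul_eq_mul]

theorem growthFactor_nonneg (alg : LRP m k n r) (p q : ℝ≥0∞) [Fact (1 ≤ p)] :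
    0 ≤ alg.growthFactor p q :=
  vecNorm_nonneg _

/-- The rounding constant of an algorithm. -/
def roundConst (_ : LRP m k n r) : ℝ := 2 ^ (m * k) + 2 ^ (k * n) + 2 ^ r

theorem roundConst_nonneg (alg : LRP m k n r) : 0 ≤ alg.roundConst := by
  unfold roundConst; positivity

theorem roundConst_bounds (alg : LRP m k n r) {ε : ℝ} (hε : 0 ≤ ε) :
    2 ^ (m * k) * ε ≤ alg.roundConst * ε ∧ 2 ^ (k * n) * ε ≤ alg.roundConst * ε ∧
      2 ^ r * ε ≤ alg.roundConst * ε := by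
  have h1 : (0 : ℝ) < 2 ^ (m * k) := by positivity
  have h2 : (0 : ℝ) < 2 ^ (k * n) := by positivity
  have h3 : (0 : ℝ) < 2 ^ r := by positivity
  unfold roundConst
  refine ⟨?_, ?_, ?_⟩ <;> gcongr <;> linarith

/-- For each output block, `bilinear_level_error` is used with the matching row of `P` as weights
and the Hölder bounds as `σ` and `τ`. The blocks then share one scalar factor, and the `p`-norm of
the remaining vector is by definition the growth factor. -/
theorem level_error {alg : LRP m k n r} (halg : alg.IsMatMul) {p q : ℝ≥0∞} [Fact (1 ≤ p)]
    [Fact (1 ≤ q)] (hp : p = 2 ∨ p = ∞) (hq : q = 2 ∨ q = ∞) {M K N : ℕ} {κ : ℝ} (hκ : 0 ≤ κ)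
    (hmul : ∀ (A : Matrix (Fin M) (Fin K) ℝ) (B : Matrix (Fin K) (Fin N) ℝ),
      matNorm p (A * B) ≤ κ * matNorm q A * matNorm q B)
    {ε g : ℝ} (hε : 0 ≤ ε) (hε1 : ε ≤ 1) (hg : 0 ≤ g)
    {A : Matrix (Fin (m * M)) (Fin (k * K)) ℝ} {B : Matrix (Fin (k * K)) (Fin (n * N)) ℝ}
    {C : Matrix (Fin (m * M)) (Fin (n * N)) ℝ} {S : Fin r → Matrix (Fin M) (Fin K) ℝ}
    {T : Fin r → Matrix (Fin K) (Fin N) ℝ} {Q : Fin r → Matrix (Fin M) (Fin N) ℝ}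
    (hS : ∀ i a b, FlDot ε (alg.L i) (fun x => block A x a b) (S i a b))
    (hT : ∀ i a b, FlDot ε (alg.R i) (fun x => block B x a b) (T i a b))
    (hQ : ∀ i, matNorm p (Q i - S i * T i) ≤ g * matNorm q (S i) * matNorm q (T i))
    (hC : ∀ x a b, FlDot ε (alg.P x) (fun i => Q i a b) (block C x a b)) :
    matNorm p (C - A * B) ≤ alg.growthFactor p q *
      (matNorm q A * matNorm q B * (g * (1 + alg.roundConst * ε) ^ 3 +
        κ * ((1 + alg.roundConst * ε) ^ 3 - 1))) := by
  set c := alg.roundConst with hc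
  have hc0 : 0 ≤ c := alg.roundConst_nonneg
  have hcε : 0 ≤ c * ε := mul_nonneg hc0 hε
  obtain ⟨hcl, hcr, hcp⟩ := alg.roundConst_bounds hε
  have hA : ∀ i, ∑ x, |alg.L i x| * matNorm q (block A x) ≤
      vecNorm q.conjExponent (alg.L i) * matNorm q A := fun i => by
    have := sum_abs_mul_abs_le hq (alg.L i) fun x => matNorm q (block A x)
    rw [vecNorm_matNorm_block hq] at this
    simpa only [abs_of_nonneg (matNorm_nonneg _)] using this
  have hB : ∀ i, ∑ x, |alg.R i x| * matNorm q (block B x) ≤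
      vecNorm q.conjExponent (alg.R i) * matNorm q B := fun i => by
    have := sum_abs_mul_abs_le hq (alg.R i) fun x => matNorm q (block B x)
    rw [vecNorm_matNorm_block hq] at this
    simpa only [abs_of_nonneg (matNorm_nonneg _)] using this
  have key : ∀ x, matNorm p (block (C - A * B) x) ≤
      (∑ i, vecNorm q.conjExponent (alg.L i) * vecNorm q.conjExponent (alg.R i) * |alg.P x i|) *
      (matNorm q A * matNorm q B * (g * (1 + c * ε) ^ 3 + κ * ((1 + c * ε) ^ 3 - 1))) := by
    intro x
    have := bilinear_level_error (matSeminorm q M K) (matSeminorm q K N) (matSeminorm p M N)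
      (matMulBilin M K N) hκ hmul (alg.P x)
      (S := fun i => ∑ y, alg.L i y • block A y) (S' := S)
      (T := fun i => ∑ y, alg.R i y • block B y) (T' := T) (Q := Q) (C := block C x)
      (σ := fun i => vecNorm q.conjExponent (alg.L i) * matNorm q A)
      (τ := fun i => vecNorm q.conjExponent (alg.R i) * matNorm q B) hcε hg
      (fun i => (Seminorm.sum_smul_le _ _ _ _).trans (hA i))
      (fun i => (Seminorm.sum_smul_le _ _ _ _).trans (hB i))
      (fun i => (matNorm_sub_sum_le hq hε hε1 hcl (hS i)).trans
        (mul_le_mul_of_nonneg_left (hA i) hcε))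
      (fun i => (matNorm_sub_sum_le hq hε hε1 hcr (hT i)).trans
        (mul_le_mul_of_nonneg_left (hB i) hcε))
      hQ (matNorm_sub_sum_le hp hε hε1 hcp (hC x))
    rw [show block (C - A * B) x = block C x - block (A * B) x from rfl, halg.block_mul]
    refine this.trans_eq ?_
    rw [Finset.sum_mul, Finset.sum_mul]
    exact Finset.sum_congr rfl fun i _ => by ring
  have hpow : (1 : ℝ) ≤ (1 + c * ε) ^ 3 := one_le_pow₀ (by linarith)
  rw [← vecNorm_matNorm_block hp, growthFactor, ← vecNorm_mul_right _ (mul_nonneg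
    (mul_nonneg (matNorm_nonneg _) (matNorm_nonneg _)) (add_nonneg (by positivity)
      (mul_nonneg hκ (by linarith))))]
  refine vecNorm_mono hp fun x => ?_
  rw [abs_of_nonneg (matNorm_nonneg _)]
  exact key x

/-- The bottom algorithm is one level over scalars: the product of reals has `κ = 1`, and its
rounding gives `g = ε`. -/
theorem base_error {base : LRP m₀ k₀ n₀ r₀} (hbase : base.IsMatMul) {p q : ℝ≥0∞} [Fact (1 ≤ p)]
    [Fact (1 ≤ q)] (hp : p = 2 ∨ p = ∞) (hq : q = 2 ∨ q = ∞) {ε : ℝ} (hε : 0 ≤ ε) (hε1 : ε ≤ 1)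
    {A : Matrix (Fin m₀) (Fin k₀) ℝ} {B : Matrix (Fin k₀) (Fin n₀) ℝ}
    {C : Matrix (Fin m₀) (Fin n₀) ℝ} {s t u : Fin r₀ → ℝ}
    (hs : ∀ i, FlDot ε (base.L i) (rowVec A) (s i))
    (ht : ∀ i, FlDot ε (base.R i) (rowVec B) (t i)) (hu : ∀ i, FlMul ε (s i) (t i) (u i))
    (hC : ∀ x, FlDot ε (base.P x) u (rowVec C x)) :
    matNorm p (C - A * B) ≤ base.growthFactor p q *
      (matNorm q A * matNorm q B * (ε * (1 + base.roundConst * ε) ^ 3 +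
        1 * ((1 + base.roundConst * ε) ^ 3 - 1))) := by
  set c := base.roundConst with hc
  have hc0 : 0 ≤ c := base.roundConst_nonneg
  have hcε : 0 ≤ c * ε := mul_nonneg hc0 hε
  obtain ⟨hcl, hcr, hcp⟩ := base.roundConst_bounds hε
  have hA : ∀ i, ∑ x, |base.L i x| * |rowVec A x| ≤
      vecNorm q.conjExponent (base.L i) * matNorm q A := fun i => sum_abs_mul_abs_le hq _ _
  have hB : ∀ i, ∑ x, |base.R i x| * |rowVec B x| ≤
      vecNorm q.conjExponent (base.R i) * matNorm q B := fun i => sum_abs_mul_abs_le hq _ _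
  have key : ∀ x, |rowVec (C - A * B) x| ≤
      (∑ i, vecNorm q.conjExponent (base.L i) * vecNorm q.conjExponent (base.R i) *
        |base.P x i|) *
      (matNorm q A * matNorm q B * (ε * (1 + c * ε) ^ 3 + 1 * ((1 + c * ε) ^ 3 - 1))) := by
    intro x
    have := bilinear_level_error (normSeminorm ℝ ℝ) (normSeminorm ℝ ℝ) (normSeminorm ℝ ℝ)
      (LinearMap.mul ℝ ℝ) zero_le_one (fun x y => by simp) (base.P x)
      (S := fun i => ∑ y, base.L i y * rowVec A y) (S' := s)
      (T := fun i => ∑ y, base.R i y * rowVec B y) (T' := t) (Q := u) (C := rowVec C x)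
      (σ := fun i => vecNorm q.conjExponent (base.L i) * matNorm q A)
      (τ := fun i => vecNorm q.conjExponent (base.R i) * matNorm q B) hcε hε
      (fun i => (Seminorm.sum_smul_le (normSeminorm ℝ ℝ) _ _ _).trans (hA i))
      (fun i => (Seminorm.sum_smul_le (normSeminorm ℝ ℝ) _ _ _).trans (hB i))
      (fun i => ((hs i).error hε hε1).trans (mul_le_mul hcl (hA i)
        (Finset.sum_nonneg fun _ _ => by positivity) hcε))
      (fun i => ((ht i).error hε hε1).trans (mul_le_mul hcr (hB i)
        (Finset.sum_nonneg fun _ _ => by positivity) hcε))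
      (fun i => by
        obtain ⟨δ, hδ, e⟩ := hu i
        change |u i - s i * t i| ≤ ε * |s i| * |t i|
        rw [e, show s i * t i * (1 + δ) - s i * t i = δ * s i * t i by ring, abs_mul, abs_mul]
        gcongr)
      (((hC x).error hε hε1).trans
          (mul_le_mul_of_nonneg_right hcp (Finset.sum_nonneg fun _ _ => by positivity)))
    have hx : rowVec (C - A * B) x = rowVec C x -
        ∑ i, base.P x i • (LinearMap.mul ℝ ℝ) (∑ y, base.L i y * rowVec A y)
          (∑ y, base.R i y * rowVec B y) := by
      rw [show rowVec (C - A * B) x = rowVec C x - rowVec (A * B) x from rfl, ← hbase A B]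
      rfl
    rw [hx]
    refine this.trans_eq ?_
    rw [Finset.sum_mul, Finset.sum_mul]
    exact Finset.sum_congr rfl fun i _ => by ring
  have hpow : (1 : ℝ) ≤ (1 + c * ε) ^ 3 := one_le_pow₀ (by linarith)
  rw [growthFactor, ← vecNorm_mul_right _ (mul_nonneg
    (mul_nonneg (matNorm_nonneg _) (matNorm_nonneg _)) (add_nonneg (by positivity)
      (by linarith)))]
  exact vecNorm_mono hp key

/-- If multiplication of the matrices handled with `ℓ` levels of recursion is bounded by
`κ * ρ ^ ℓ` with `ρ < γ`, then the recursive algorithm has an error bound function of the form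
`F * γ ^ ℓ`. -/
theorem exists_isErrorBoundFunction {alg : LRP m k n r} (halg : alg.IsMatMul) {p q : ℝ≥0∞}
    [Fact (1 ≤ p)] [Fact (1 ≤ q)] (hp : p = 2 ∨ p = ∞) (hq : q = 2 ∨ q = ∞)
    {base : LRP m₀ k₀ n₀ r₀} (hbase : base.IsMatMul) {κ ρ : ℝ} (hκ : 0 ≤ κ) (hρ : 0 ≤ ρ)
    (hργ : ρ < alg.growthFactor p q)
    (hmul : ∀ ℓ (A : Matrix (Fin (recDim m m₀ ℓ)) (Fin (recDim k k₀ ℓ)) ℝ)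
      (B : Matrix (Fin (recDim k k₀ ℓ)) (Fin (recDim n n₀ ℓ)) ℝ),
      matNorm p (A * B) ≤ κ * ρ ^ ℓ * matNorm q A * matNorm q B) :
    ∃ F : ℝ, alg.IsErrorBoundFunction base p q fun ℓ => F * alg.growthFactor p q ^ ℓ := by
  set γ := alg.growthFactor p q with hγ
  have hγ0 : 0 < γ := hρ.trans_lt hργ
  set c := alg.roundConst
  have hc0 : 0 ≤ c := alg.roundConst_nonneg
  set c₀ := base.roundConst
  have hc₀ : 0 ≤ c₀ := base.roundConst_nonneg
  set γ₀ := base.growthFactor p q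
  have hγ₀ : 0 ≤ γ₀ := base.growthFactor_nonneg p q
  -- A particular solution of the recurrence for the first-order coefficient: `-G ρ ^ ℓ` absorbs the
  -- forcing term because `G (γ - ρ) = 3 c κ γ`. With `ρ = γ` a factor `ℓ` would appear instead.
  set G := 3 * c * κ * γ / (γ - ρ) with hG
  have hγρ : 0 < γ - ρ := by linarith
  have hG0 : 0 ≤ G := by positivity
  have hGe : G * (γ - ρ) = 3 * c * κ * γ := by rw [hG]; field_simp
  -- Chosen so that the coefficient `F - G` at level `0` is exactly the first-order error of the
  -- bottom algorithm.
  set F := γ₀ * (1 + 3 * c₀ * 1) + G with hF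
  have hF0 : 0 ≤ F := by positivity
  -- The bound `F * γ ^ ℓ` alone would not pass through the induction; the subtracted `G * ρ ^ ℓ`
  -- pays for the roundings of each new level.
  suffices H : ∀ ℓ : ℕ, ∃ D : ℝ, 0 ≤ D ∧ ∀ ε : ℝ, 0 ≤ ε → ε ≤ 1 →
      ∀ (A : Matrix (Fin (recDim m m₀ ℓ)) (Fin (recDim k k₀ ℓ)) ℝ)
        (B : Matrix (Fin (recDim k k₀ ℓ)) (Fin (recDim n n₀ ℓ)) ℝ)
        (C : Matrix (Fin (recDim m m₀ ℓ)) (Fin (recDim n n₀ ℓ)) ℝ),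
        alg.Computed base ε ℓ A B C → matNorm p (C - A * B) ≤
          ((F * γ ^ ℓ - G * ρ ^ ℓ) * ε + D * ε ^ 2) * matNorm q A * matNorm q B by
    refine ⟨F, fun ℓ => ?_⟩
    obtain ⟨D, -, hD⟩ := H ℓ
    refine ⟨D, fun ε hε hε1 A B C h => (hD ε hε hε1 A B C h).trans ?_⟩
    have : 0 ≤ G * ρ ^ ℓ * ε * (matNorm q A * matNorm q B) :=
      mul_nonneg (by positivity) (mul_nonneg (matNorm_nonneg _) (matNorm_nonneg _))
    linarith
  intro ℓ
  induction ℓ with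
  | zero =>
    refine ⟨γ₀ * (1 * (3 * c₀ + 3 * c₀ ^ 2 + c₀ ^ 3) + 0 * (1 + c₀) ^ 3 +
      1 * (3 * c₀ ^ 2 + c₀ ^ 3)), by positivity, ?_⟩
    rintro ε hε hε1 A B C ⟨s, t, u, hs, ht, hu, hC⟩
    have h1 := level_error_le hc₀ zero_le_one zero_le_one le_rfl hε hε1 (κ := 1)
    rw [zero_mul, add_zero, one_mul] at h1
    refine (base_error hbase hp hq hε hε1 hs ht hu hC).trans
      ((mul_le_mul_of_nonneg_left (mul_le_mul_of_nonneg_left h1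
        (mul_nonneg (matNorm_nonneg _) (matNorm_nonneg _))) hγ₀).trans_eq ?_)
    rw [hF, pow_zero, pow_zero]
    change γ₀ * (matNorm q A * matNorm q B * _) = _ * matNorm q A * matNorm q B
    ring
  | succ ℓ ih =>
    obtain ⟨D, hD0, hD⟩ := ih
    set f := F * γ ^ ℓ - G * ρ ^ ℓ with hf
    have hf0 : 0 ≤ f := by
      have h1 : ρ ^ ℓ ≤ γ ^ ℓ := pow_le_pow_left₀ hρ hργ.le ℓ
      have h2 : G * ρ ^ ℓ ≤ F * γ ^ ℓ := by
        gcongr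
        rw [hF]
        have : 0 ≤ γ₀ * (1 + 3 * c₀ * 1) := by positivity
        linarith
      linarith
    have hκ' : 0 ≤ κ * ρ ^ ℓ := by positivity
    refine ⟨γ * (f * (3 * c + 3 * c ^ 2 + c ^ 3) + D * (1 + c) ^ 3 +
      κ * ρ ^ ℓ * (3 * c ^ 2 + c ^ 3)), by positivity, ?_⟩
    rintro ε hε hε1 A B C ⟨S, T, Q, hS, hT, hQ, hC⟩
    have h1 := level_error_le hc0 hκ' hf0 hD0 hε hε1
    have h2 := level_error halg hp hq hκ' (hmul ℓ) hε hε1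
      (by positivity : 0 ≤ f * ε + D * ε ^ 2) hS hT (fun i => hD ε hε hε1 _ _ _ (hQ i)) hC
    refine h2.trans ((mul_le_mul_of_nonneg_left (mul_le_mul_of_nonneg_left h1
        (mul_nonneg (matNorm_nonneg _) (matNorm_nonneg _))) hγ0.le).trans_eq ?_)
    have e : F * γ ^ (ℓ + 1) - G * ρ ^ (ℓ + 1) = γ * (f + 3 * c * (κ * ρ ^ ℓ)) := by
      rw [hf, pow_succ, pow_succ]
      linear_combination ρ ^ ℓ * hGe
    rw [e]
    change γ * (matNorm q A * matNorm q B * _) = _ * matNorm q A * matNorm q B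
    ring

theorem hasForwardErrorBound {alg : LRP m k n r} (halg : alg.IsMatMul) {p q : ℝ≥0∞}
    [Fact (1 ≤ p)] [Fact (1 ≤ q)] (hp : p = 2 ∨ p = ∞) (hq : q = 2 ∨ q = ∞) (hk : 1 < k) {ρ : ℝ}
    (hρ : 0 ≤ ρ) (hργ : ρ < alg.growthFactor p q)
    (hmul : ∀ m₀ k₀ n₀ : ℕ, ∃ κ : ℝ, 0 ≤ κ ∧
      ∀ ℓ (A : Matrix (Fin (recDim m m₀ ℓ)) (Fin (recDim k k₀ ℓ)) ℝ)
      (B : Matrix (Fin (recDim k k₀ ℓ)) (Fin (recDim n n₀ ℓ)) ℝ),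
      matNorm p (A * B) ≤ κ * ρ ^ ℓ * matNorm q A * matNorm q B) :
    alg.HasForwardErrorBound p q := by
  intro m₀ k₀ n₀ r₀ base _ hk₀ _ hbase
  obtain ⟨κ, hκ, hκm⟩ := hmul m₀ k₀ n₀
  obtain ⟨F, hF⟩ := exists_isErrorBoundFunction halg hp hq hbase hκ hρ hργ hκm
  set γ := alg.growthFactor p q with hγ
  have hγ0 : 0 < γ := hρ.trans_lt hργ
  have hk0 : (0 : ℝ) < k := by exact_mod_cast (by omega : 0 < k)
  have hk₀' : (0 : ℝ) < k₀ := by exact_mod_cast hk₀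
  have hpow : ∀ ℓ : ℕ, ((k : ℝ) ^ ℓ) ^ alg.errorExponent p q = γ ^ ℓ := fun ℓ => by
    rw [← Real.rpow_natCast, ← Real.rpow_mul hk0.le, mul_comm, Real.rpow_mul hk0.le, errorExponent,
      Real.rpow_logb hk0 (by exact_mod_cast hk.ne') hγ0, Real.rpow_natCast]
  have h1 : (fun ℓ : ℕ => F * γ ^ ℓ) =O[atTop] fun ℓ => γ ^ ℓ :=
    (isBigO_refl _ _).const_mul_left F
  refine ⟨_, hF, h1, ?_, ?_⟩
  · have e : (fun ℓ => ((recDim k k₀ ℓ : ℝ) / k₀) ^ alg.errorExponent p q) = fun ℓ => γ ^ ℓ := by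
      ext ℓ
      rw [recDim_cast, mul_div_cancel_left₀ _ hk₀'.ne', hpow]
    rw [e]; exact h1
  · have e : (fun ℓ => (recDim k k₀ ℓ : ℝ) ^ alg.errorExponent p q) =
        fun ℓ => (k₀ : ℝ) ^ alg.errorExponent p q * γ ^ ℓ := by
      ext ℓ
      rw [recDim_cast, Real.mul_rpow hk₀'.le (by positivity), hpow]
    rw [e]
    exact h1.trans (isBigO_self_const_mul (Real.rpow_pos_of_pos hk₀' _).ne' _ _)

end LRP

/-! ### Norms of products -/

theorem matNorm_two_mul_le {M K N : ℕ} (A : Matrix (Fin M) (Fin K) ℝ)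
    (B : Matrix (Fin K) (Fin N) ℝ) : matNorm 2 (A * B) ≤ matNorm 2 A * matNorm 2 B := by
  rw [matNorm_two, matNorm_two, matNorm_two, ← Real.sqrt_mul (by positivity)]
  apply Real.sqrt_le_sqrt
  rw [Finset.sum_comm (f := fun i j => B i j ^ 2), Finset.sum_mul_sum]
  refine Finset.sum_le_sum fun i _ => Finset.sum_le_sum fun j _ => ?_
  rw [Matrix.mul_apply]
  exact Finset.sum_mul_sq_le_sq_mul_sq _ _ _

theorem matNorm_top_le_two {M K : ℕ} (A : Matrix (Fin M) (Fin K) ℝ) :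
    matNorm ∞ A ≤ matNorm 2 A := by
  rw [matNorm_top_le_iff (matNorm_nonneg _), matNorm_two]
  intro i j
  apply Real.abs_le_sqrt
  calc A i j ^ 2 ≤ ∑ j, A i j ^ 2 :=
        Finset.single_le_sum (f := fun j => A i j ^ 2) (fun _ _ => sq_nonneg _) (Finset.mem_univ j)
    _ ≤ ∑ i, ∑ j, A i j ^ 2 :=
        Finset.single_le_sum (f := fun i => ∑ j, A i j ^ 2)
          (fun _ _ => Finset.sum_nonneg fun _ _ => sq_nonneg _) (Finset.mem_univ i)

theorem matNorm_top_mul_le {M K N : ℕ} (A : Matrix (Fin M) (Fin K) ℝ)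
    (B : Matrix (Fin K) (Fin N) ℝ) : matNorm ∞ (A * B) ≤ K * matNorm ∞ A * matNorm ∞ B := by
  have hA := matNorm_nonneg (p := ∞) A
  have hB := matNorm_nonneg (p := ∞) B
  rw [matNorm_top_le_iff (by positivity)]
  intro i j
  rw [Matrix.mul_apply]
  refine (Finset.abs_sum_le_sum_abs _ _).trans ?_
  calc ∑ l, |A i l * B l j| ≤ ∑ _l : Fin K, matNorm ∞ A * matNorm ∞ B := by
        refine Finset.sum_le_sum fun l _ => ?_
        rw [abs_mul]
        exact mul_le_mul (abs_le_matNorm_top A i l) (abs_le_matNorm_top B l j) (abs_nonneg _) hA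
    _ = K * matNorm ∞ A * matNorm ∞ B := by simp [mul_assoc]

theorem matNorm_two_le_top {M N : ℕ} (A : Matrix (Fin M) (Fin N) ℝ) :
    matNorm 2 A ≤ √(M * N) * matNorm ∞ A := by
  rw [matNorm_two, Real.sqrt_le_left (mul_nonneg (Real.sqrt_nonneg _) (matNorm_nonneg _)), mul_pow,
    Real.sq_sqrt (by positivity)]
  calc ∑ i, ∑ j, A i j ^ 2 ≤ ∑ _i : Fin M, ∑ _j : Fin N, matNorm ∞ A ^ 2 :=
        Finset.sum_le_sum fun i _ => Finset.sum_le_sum fun j _ =>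
          sq_le_sq.2 ((abs_le_matNorm_top A i j).trans (le_abs_self _))
    _ = M * N * matNorm ∞ A ^ 2 := by simp [mul_assoc]

namespace LRP

variable {m k n r : ℕ}

/-- The Frobenius norm is submultiplicative and dominates the max-norm, so exact products do not
grow with the dimension: `κ = ρ = 1`. -/
theorem hasForwardErrorBound_two {alg : LRP m k n r} (halg : alg.IsMatMul) {p : ℝ≥0∞}
    [Fact (1 ≤ p)] (hp : p = 2 ∨ p = ∞) (hk : 1 < k) (hγ : 1 < alg.growthFactor p 2) :
    alg.HasForwardErrorBound p 2 :=
  hasForwardErrorBound halg hp (.inl rfl) hk zero_le_one hγ fun _ _ _ =>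
    ⟨1, zero_le_one, fun ℓ A B => by
      rw [one_pow, one_mul, one_mul]
      rcases hp with rfl | rfl
      · exact matNorm_two_mul_le A B
      · exact (matNorm_top_le_two _).trans (matNorm_two_mul_le A B)⟩

/-- Here an entry of the product costs the inner dimension `k₀ * k ^ ℓ`, whence `ρ = k`. -/
theorem hasForwardErrorBound_top_top {alg : LRP m k n r} (halg : alg.IsMatMul) (hk : 1 < k)
    (hγ : k < alg.growthFactor ∞ ∞) : alg.HasForwardErrorBound ∞ ∞ :=
  hasForwardErrorBound halg (.inr rfl) (.inr rfl) hk (Nat.cast_nonneg k) hγ fun _ k₀ _ =>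
    ⟨k₀, Nat.cast_nonneg _, fun ℓ A B => by
      rw [← recDim_cast]
      exact matNorm_top_mul_le A B⟩

/-- Passing the output from max-norm to `2`-norm costs the square root of its number of entries, a
further `√(m * n)` per level. -/
theorem hasForwardErrorBound_two_top {alg : LRP m k n r} (halg : alg.IsMatMul) (hk : 1 < k)
    (hγ : √(m * n) * k < alg.growthFactor 2 ∞) : alg.HasForwardErrorBound 2 ∞ :=
  hasForwardErrorBound halg (.inl rfl) (.inr rfl) hk (by positivity) hγ fun m₀ k₀ n₀ =>
    ⟨√(m₀ * n₀) * k₀, by positivity, fun ℓ A B => by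
      refine (matNorm_two_le_top _).trans
        ((mul_le_mul_of_nonneg_left (matNorm_top_mul_le A B) (Real.sqrt_nonneg _)).trans_eq ?_)
      have e : √((recDim m m₀ ℓ : ℝ) * recDim n n₀ ℓ) = √(m₀ * n₀) * √(m * n) ^ ℓ := by
        rw [recDim_cast, recDim_cast, show (m₀ * (m : ℝ) ^ ℓ) * (n₀ * (n : ℝ) ^ ℓ) =
          (m₀ * n₀) * (√(m * n) ^ ℓ) ^ 2 by
            rw [← pow_mul, mul_comm ℓ 2, pow_mul, Real.sq_sqrt (by positivity), mul_pow]; ring,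
          Real.sqrt_mul (by positivity), Real.sqrt_sq (by positivity)]
      rw [e, recDim_cast, mul_pow]
      ring⟩

end LRP

/-! ### Correctness of explicit algorithms -/

/-- Both sides are bilinear in `(A, B)`, so it suffices to compare the coefficients of the products
of entries (Brent's equations). -/
theorem LRP.isMatMul_of_tensor {m k n r : ℕ} (alg : LRP m k n r)
    (h : ∀ i j a b c d, ∑ s, alg.P (finProdFinEquiv (i, j)) s *
      (alg.L s (finProdFinEquiv (a, b)) * alg.R s (finProdFinEquiv (c, d))) =
        if b = c ∧ i = a ∧ j = d then 1 else 0) : alg.IsMatMul := by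
  intro A B
  ext x
  obtain ⟨⟨i, j⟩, rfl⟩ := finProdFinEquiv.surjective x
  have e : alg.beta A B (finProdFinEquiv (i, j)) = ∑ y, ∑ z,
      (∑ s, alg.P (finProdFinEquiv (i, j)) s * (alg.L s y * alg.R s z)) *
        (rowVec A y * rowVec B z) := by
    simp only [LRP.beta, Matrix.mulVec, dotProduct, Pi.mul_apply]
    simp_rw [Finset.sum_mul_sum, Finset.mul_sum, Finset.sum_mul]
    rw [Finset.sum_comm]
    refine Finset.sum_congr rfl fun y _ => ?_
    rw [Finset.sum_comm]
    exact Finset.sum_congr rfl fun z _ => Finset.sum_congr rfl fun s _ => by ring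
  rw [e, rowVec_apply, Matrix.mul_apply]
  simp only [sum_finProd, h, rowVec_apply, ite_and, ite_mul, one_mul, zero_mul]
  simp

/-- The lowest digit is divisible by `B` and smaller than `B` in absolute value, hence zero;
dividing by `B` gives the induction. -/
theorem Int.eq_zero_of_sum_mul_pow_eq_zero {B : ℤ} (hB : 0 < B) :
    ∀ {n : ℕ} {d : Fin n → ℤ}, (∀ x, |d x| < B) → ∑ x, d x * B ^ (x : ℕ) = 0 → ∀ x, d x = 0
  | 0, _, _, _ => fun x => x.elim0
  | n + 1, d, hd, h => by
    rw [Fin.sum_univ_succ] at h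
    have e : ∑ x : Fin n, d x.succ * B ^ (x.succ : ℕ) =
        B * ∑ x : Fin n, d x.succ * B ^ (x : ℕ) := by
      rw [Finset.mul_sum]
      exact Finset.sum_congr rfl fun x _ => by rw [Fin.val_succ, pow_succ]; ring
    rw [e, Fin.val_zero, pow_zero, mul_one] at h
    have h0 : d 0 = 0 := Int.eq_zero_of_abs_lt_dvd
      ⟨-(∑ x : Fin n, d x.succ * B ^ (x : ℕ)), by rw [mul_neg]; linarith⟩ (hd 0)
    rw [h0, zero_add] at h
    have h1 := (mul_eq_zero.1 h).resolve_left hB.ne'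
    intro x
    refine Fin.cases h0 (fun x => ?_) x
    exact Int.eq_zero_of_sum_mul_pow_eq_zero hB (fun x => hd x.succ) h1 x

/-- The algorithm for `4 × 4` matrices with `48` products given by integer matrices `L`, `R` and
`8 P`. -/
noncomputable def intAlg (L R : Matrix (Fin 48) (Fin 16) ℤ) (P : Matrix (Fin 16) (Fin 48) ℤ) :
    LRP 4 4 4 48 where
  L := L.map fun z : ℤ => (z : ℝ)
  R := R.map fun z : ℤ => (z : ℝ)
  P := P.map fun z : ℤ => (z : ℝ) / 8

/-- The columns of `P` are packed into integers, so that each coefficient of the tensor is read off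
as a digit in base `1024`. -/
theorem intAlg_isMatMul {L R : Matrix (Fin 48) (Fin 16) ℤ} {P : Matrix (Fin 16) (Fin 48) ℤ}
    (hL : ∀ s y, |L s y| ≤ 1) (hR : ∀ s z, |R s z| ≤ 2) (hP : ∀ x s, |P x s| ≤ 4)
    (h : ∀ y z : Fin 16, ∑ s, (∑ x, P x s * 1024 ^ (x : ℕ)) * (L s y * R s z) =
      if y.val % 4 = z.val / 4 then 8 * 1024 ^ (4 * (y.val / 4) + z.val % 4) else 0) :
    (intAlg L R P).IsMatMul := by
  have key : ∀ x y z : Fin 16, ∑ s, P x s * (L s y * R s z) =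
      if y.val % 4 = z.val / 4 ∧ x.val = 4 * (y.val / 4) + z.val % 4 then 8 else 0 := by
    intro x y z
    set e : Fin 16 → ℤ := fun x =>
      if y.val % 4 = z.val / 4 ∧ x.val = 4 * (y.val / 4) + z.val % 4 then 8 else 0 with he
    have hlt : 4 * (y.val / 4) + z.val % 4 < 16 := by omega
    have hsum : ∑ x, (∑ s, P x s * (L s y * R s z) - e x) * 1024 ^ (x : ℕ) = 0 := by
      have e1 : ∑ x : Fin 16, e x * 1024 ^ (x : ℕ) =
          if y.val % 4 = z.val / 4 then 8 * 1024 ^ (4 * (y.val / 4) + z.val % 4) else 0 := by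
        rw [Finset.sum_eq_single ⟨4 * (y.val / 4) + z.val % 4, hlt⟩]
        · simp [he]
        · intro b _ hb
          have : ¬ b.val = 4 * (y.val / 4) + z.val % 4 := fun hb' => hb (Fin.ext hb')
          simp [he, this]
        · simp
      simp_rw [sub_mul]
      rw [Finset.sum_sub_distrib, e1, ← h y z, sub_eq_zero]
      simp_rw [Finset.sum_mul]
      rw [Finset.sum_comm]
      exact Finset.sum_congr rfl fun s _ => Finset.sum_congr rfl fun x _ => by ring
    refine sub_eq_zero.1 (Int.eq_zero_of_sum_mul_pow_eq_zero (B := 1024) (by norm_num)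
      (fun x => ?_) hsum x)
    -- The sum is at most `48 * 8 = 384` in absolute value, and the target at most `8`, so the
    -- digits stay below the base `1024`.
    have h1 : |∑ s, P x s * (L s y * R s z)| ≤ ∑ _s : Fin 48, (4 * (1 * 2) : ℤ) := by
      refine (Finset.abs_sum_le_sum_abs _ _).trans (Finset.sum_le_sum fun s _ => ?_)
      rw [abs_mul, abs_mul]
      exact mul_le_mul (hP x s) (mul_le_mul (hL s y) (hR s z) (abs_nonneg _) zero_le_one)
        (by positivity) (by norm_num)
    have h2 : |e x| ≤ 8 := by
      rw [he]; dsimp only; split_ifs <;> simp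
    have h3 := abs_sub (∑ s, P x s * (L s y * R s z)) (e x)
    simp only [Finset.sum_const, Finset.card_univ, Fintype.card_fin, nsmul_eq_mul] at h1
    norm_num at h1
    linarith
  refine LRP.isMatMul_of_tensor _ fun i j a b c d => ?_
  have h1 := congrArg (fun z : ℤ => (z : ℝ) / 8)
    (key (finProdFinEquiv (i, j)) (finProdFinEquiv (a, b)) (finProdFinEquiv (c, d)))
  have h2 : (b + 4 * a.val) % 4 = (d + 4 * c.val) / 4 ∧
      j + 4 * i.val = 4 * ((b + 4 * a.val) / 4) + (d + 4 * c.val) % 4 ↔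
        b = c ∧ i = a ∧ j = d := by
    simp only [Fin.ext_iff]; omega
  simp only [finProdFinEquiv_apply_val, h2] at h1
  have h3 : ∀ φ : Prop, ∀ [Decidable φ], (((if φ then 8 else 0 : ℤ) : ℝ) / 8) =
      if φ then 1 else 0 := fun φ _ => by split_ifs <;> norm_num
  rw [h3] at h1
  rw [← h1]
  push_cast
  rw [Finset.sum_div]
  exact Finset.sum_congr rfl fun s _ => by simp [intAlg]; ring

set_option maxRecDepth 100000 in
theorem newAlg_isMatMul : newAlg.IsMatMul :=
  intAlg_isMatMul (L := newL) (R := newR) (P := newP8) (by decide +kernel) (by decide +kernel)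
    (by decide +kernel) (by decide +kernel)

set_option maxRecDepth 100000 in
theorem dps25_isMatMul : dps25.IsMatMul :=
  intAlg_isMatMul (L := dps25L) (R := dps25R) (P := dps25P8) (by decide +kernel)
    (by decide +kernel) (by decide +kernel) (by decide +kernel)

theorem strassen_isMatMul : strassen.IsMatMul := by
  apply LRP.isMatMul_of_tensor
  intro i j a b c d
  fin_cases i <;> fin_cases j <;> fin_cases a <;> fin_cases b <;> fin_cases c <;> fin_cases d <;>
    simp [strassen, Fin.sum_univ_succ, finProdFinEquiv]

theorem winograd_isMatMul : winograd.IsMatMul := by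
  apply LRP.isMatMul_of_tensor
  intro i j a b c d
  fin_cases i <;> fin_cases j <;> fin_cases a <;> fin_cases b <;> fin_cases c <;> fin_cases d <;>
    simp [winograd, Fin.sum_univ_succ, finProdFinEquiv]

theorem dps24_isMatMul : dps24.IsMatMul := by
  have h2 : √3 ^ 2 = (3 : ℝ) := Real.sq_sqrt (by norm_num)
  apply LRP.isMatMul_of_tensor
  intro i j a b c d
  fin_cases i <;> fin_cases j <;> fin_cases a <;> fin_cases b <;> fin_cases c <;> fin_cases d <;>
    simp [dps24, Fin.sum_univ_succ, finProdFinEquiv] <;> ring_nf <;> simp only [h2] <;> ring_nf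

/-! ### Growth factors -/

theorem vecNorm_top_eq {ι : Type} [Fintype ι] {v : ι → ℝ} {c : ℝ} (h0 : ∀ i, 0 ≤ v i)
    (h : ∀ i, v i ≤ c) (i : ι) (hi : v i = c) : vecNorm ∞ v = c :=
  le_antisymm ((vecNorm_top_le_iff (hi ▸ h0 i)).2 fun j => (abs_of_nonneg (h0 j)).trans_le (h j))
    (hi ▸ (le_abs_self _).trans (abs_le_vecNorm_top v i))

theorem vecNorm_top_const {v : Fin (4 * 4) → ℝ} {c : ℝ} (hc : 0 ≤ c) (h : ∀ i, v i = c) :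
    vecNorm ∞ v = c :=
  vecNorm_top_eq (fun i => (h i).symm ▸ hc) (fun i => (h i).le) 0 (h 0)

theorem vecNorm_two_const {v : Fin (4 * 4) → ℝ} {c : ℝ} (hc : 0 ≤ c) (h : ∀ i, v i = c) :
    vecNorm 2 v = 4 * c := by
  rw [vecNorm_two]
  simp only [h]
  rw [Real.sqrt_eq_iff_mul_self_eq (by positivity) (by positivity)]
  simp
  ring

/-- The terms of the growth factors of `intAlg L R P` for the norm `2` of the inputs, grouped by the
product of the squared norms of the rows of `L` and `R`. -/
theorem intAlg_row_two (L R : Matrix (Fin 48) (Fin 16) ℤ) (P : Matrix (Fin 16) (Fin 48) ℤ)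
    (t : Finset ℤ) (ht : ∀ s, (∑ y, L s y ^ 2) * (∑ z, R s z ^ 2) ∈ t) (x : Fin 16) :
    ∑ s, vecNorm 2 ((intAlg L R P).L s) * vecNorm 2 ((intAlg L R P).R s) *
      |(intAlg L R P).P x s| =
    ∑ a ∈ t, √(a : ℝ) / 8 *
      ((∑ s with (∑ y, L s y ^ 2) * (∑ z, R s z ^ 2) = a, |P x s| : ℤ) : ℝ) := by
  rw [← Finset.sum_fiberwise_of_maps_to (fun s _ => ht s)]
  refine Finset.sum_congr rfl fun a _ => ?_
  rw [Int.cast_sum, Finset.mul_sum]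
  refine Finset.sum_congr rfl fun s hs => ?_
  rw [← (Finset.mem_filter.1 hs).2, vecNorm_two, vecNorm_two, ← Real.sqrt_mul
    (Finset.sum_nonneg fun _ _ => sq_nonneg _)]
  simp only [intAlg, Matrix.map_apply, abs_div, Int.cast_mul, Int.cast_sum, Int.cast_pow,
    Int.cast_abs, Nat.abs_ofNat]
  ring

theorem intAlg_row_one (L R : Matrix (Fin 48) (Fin 16) ℤ) (P : Matrix (Fin 16) (Fin 48) ℤ)
    (x : Fin 16) :
    ∑ s, vecNorm 1 ((intAlg L R P).L s) * vecNorm 1 ((intAlg L R P).R s) *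
      |(intAlg L R P).P x s| =
    ((∑ s, (∑ y, |L s y|) * (∑ z, |R s z|) * |P x s| : ℤ) : ℝ) / 8 := by
  rw [Int.cast_sum, Finset.sum_div]
  refine Finset.sum_congr rfl fun s _ => ?_
  rw [vecNorm_one, vecNorm_one]
  simp only [intAlg, Matrix.map_apply, abs_div, Int.cast_mul, Int.cast_sum,
    Int.cast_abs, Nat.abs_ofNat]
  ring

set_option maxRecDepth 100000 in
theorem newAlg_row_top (x : Fin (4 * 4)) :
    ∑ s, vecNorm 1 (newAlg.L s) * vecNorm 1 (newAlg.R s) * |newAlg.P x s| = 224 := by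
  have h : ∀ x, ∑ s, (∑ y, |newL s y|) * (∑ z, |newR s z|) * |newP8 x s| = 1792 := by
    decide +kernel
  refine (intAlg_row_one newL newR newP8 x).trans ?_
  rw [h]; norm_num

theorem sqrt_64 : √(64 : ℝ) = 8 := by
  rw [show (64 : ℝ) = 8 ^ 2 by norm_num, Real.sqrt_sq (by norm_num)]

theorem sqrt_128 : √(128 : ℝ) = 8 * √2 := by
  rw [show (128 : ℝ) = 8 ^ 2 * 2 by norm_num, Real.sqrt_mul (by norm_num),
    Real.sqrt_sq (by norm_num)]

-- The product of squared row norms is `64` or `128`, and every row of `8 P` puts total weight `16`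
-- on the first class and `8` on the second. All entries of the vector therefore agree, which makes
-- its `2`-norm four times its max-norm.
set_option maxRecDepth 100000 in
theorem newAlg_row_two (x : Fin (4 * 4)) :
    ∑ s, vecNorm 2 (newAlg.L s) * vecNorm 2 (newAlg.R s) * |newAlg.P x s| = 16 + 8 * √2 := by
  have ht : ∀ s, (∑ y, newL s y ^ 2) * (∑ z, newR s z ^ 2) ∈ ({64, 128} : Finset ℤ) := by
    decide +kernel
  have h1 : ∀ x, ∑ s with (∑ y, newL s y ^ 2) * (∑ z, newR s z ^ 2) = 64, |newP8 x s| = 16 := by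
    decide +kernel
  have h2 : ∀ x, ∑ s with (∑ y, newL s y ^ 2) * (∑ z, newR s z ^ 2) = 128, |newP8 x s| = 8 := by
    decide +kernel
  refine (intAlg_row_two newL newR newP8 _ ht x).trans ?_
  rw [Finset.sum_insert (by decide), Finset.sum_singleton, h1, h2]
  push_cast
  rw [sqrt_64, sqrt_128]
  ring

theorem newAlg_growthFactor_top_top : newAlg.growthFactor ∞ ∞ = 224 := by
  rw [LRP.growthFactor, conjExponent_top]
  exact vecNorm_top_const (by norm_num) newAlg_row_top

theorem newAlg_growthFactor_two_top : newAlg.growthFactor 2 ∞ = 896 := by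
  rw [LRP.growthFactor, conjExponent_top, vecNorm_two_const (by norm_num) newAlg_row_top]
  norm_num

theorem newAlg_growthFactor_top_two : newAlg.growthFactor ∞ 2 = 16 + 8 * √2 := by
  rw [LRP.growthFactor, conjExponent_two]
  exact vecNorm_top_const (by positivity) newAlg_row_two

theorem newAlg_growthFactor_two_two : newAlg.growthFactor 2 2 = 64 + 32 * √2 := by
  rw [LRP.growthFactor, conjExponent_two, vecNorm_two_const (by positivity) newAlg_row_two]
  ring

theorem winograd_growthFactor : winograd.growthFactor ∞ 2 = 8 := by
  have hw : ∀ s, vecNorm 2 (winograd.L s) * vecNorm 2 (winograd.R s) =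
      (![1, 1, 2, 2, 2, 3, 2] : Fin 7 → ℝ) s := by
    intro s
    rw [vecNorm_two, vecNorm_two, ← Real.sqrt_mul (by positivity), Real.sqrt_eq_iff_mul_self_eq
      (by positivity) (by fin_cases s <;> simp)]
    fin_cases s <;> simp [winograd, Fin.sum_univ_succ] <;> norm_num
  rw [LRP.growthFactor, conjExponent_two]
  simp only [hw]
  refine vecNorm_top_eq (fun x => ?_) (fun x => ?_) 1 ?_
  · fin_cases x <;> simp [winograd, Fin.sum_univ_succ] <;> norm_num
  · fin_cases x <;> simp [winograd, Fin.sum_univ_succ] <;> norm_num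
  · simp [winograd, Fin.sum_univ_succ]; norm_num

theorem strassen_growthFactor : strassen.growthFactor ∞ 2 = 4 + 2 * √2 := by
  have h2 : √2 ^ 2 = (2 : ℝ) := Real.sq_sqrt (by norm_num)
  have h0 : 0 < √(2 : ℝ) := by positivity
  have hw : ∀ s, vecNorm 2 (strassen.L s) * vecNorm 2 (strassen.R s) =
      (![2, √2, √2, √2, √2, 2, 2] : Fin 7 → ℝ) s := by
    intro s
    rw [vecNorm_two, vecNorm_two, ← Real.sqrt_mul (by positivity), Real.sqrt_eq_iff_mul_self_eq
      (by positivity) (by fin_cases s <;> simp)]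
    fin_cases s <;> simp [strassen, Fin.sum_univ_succ] <;> norm_num
  rw [LRP.growthFactor, conjExponent_two]
  simp only [hw]
  refine vecNorm_top_eq (fun x => ?_) (fun x => ?_) 0 ?_
  · fin_cases x <;> simp [strassen, Fin.sum_univ_succ] <;> positivity
  · fin_cases x <;> simp [strassen, Fin.sum_univ_succ] <;> nlinarith
  · simp [strassen, Fin.sum_univ_succ]; ring

theorem dps24_growthFactor : dps24.growthFactor ∞ 2 = 31 / 9 * √3 := by
  have h2 : √3 ^ 2 = (3 : ℝ) := Real.sq_sqrt (by norm_num)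
  have h4 : √3 ^ 4 = (9 : ℝ) := by rw [show 4 = 2 * 2 from rfl, pow_mul, h2]; norm_num
  have h0 : 0 < √(3 : ℝ) := by positivity
  have hw0 : ∀ s, 0 ≤ (![2, 4 / 3, 4 / 3, 4 / 3, 4 / 3, 4 / 3, 4 / 3] : Fin 7 → ℝ) s := by
    intro s
    fin_cases s <;> norm_num
  have hw : ∀ s, vecNorm 2 (dps24.L s) * vecNorm 2 (dps24.R s) =
      (![2, 4 / 3, 4 / 3, 4 / 3, 4 / 3, 4 / 3, 4 / 3] : Fin 7 → ℝ) s := by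
    intro s
    rw [vecNorm_two, vecNorm_two, ← Real.sqrt_mul (by positivity), Real.sqrt_eq_iff_mul_self_eq
      (by positivity) (hw0 s)]
    fin_cases s <;> simp [dps24, Fin.sum_univ_succ] <;> ring_nf <;> norm_num [h2, h4]
  -- Needed for the first and last rows of `P`, whose sum `13 / 3` contains no `√3`.
  have h17 : (1.7 : ℝ) < √3 := Real.lt_sqrt_of_sq_lt (by norm_num)
  rw [LRP.growthFactor, conjExponent_two]
  simp only [hw]
  refine vecNorm_top_eq (fun x => ?_) (fun x => ?_) 2 ?_
  · exact Finset.sum_nonneg fun s _ => mul_nonneg (hw0 s) (abs_nonneg _)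
  · fin_cases x <;> simp [dps24, Fin.sum_univ_succ, abs_div, abs_mul, abs_of_pos h0] <;> linarith
  · simp [dps24, Fin.sum_univ_succ, abs_div, abs_mul, abs_of_pos h0]; ring

set_option maxRecDepth 100000 in
theorem dps25_growthFactor : dps25.growthFactor ∞ 2 = 10 + 14 * √2 + 2 * √6 + 2 * √3 := by
  have ht : ∀ s, (∑ y, dps25L s y ^ 2) * (∑ z, dps25R s z ^ 2) ∈
      ({8, 16, 24, 32, 48, 64, 96, 128} : Finset ℤ) := by
    decide +kernel
  -- Row `0` carries the largest weight in every class separately, so it attains the maximum without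
  -- any comparison of square roots.
  have h : ∀ a ∈ ({8, 16, 24, 32, 48, 64, 96, 128} : Finset ℤ), ∀ x : Fin 16,
      ∑ s with (∑ y, dps25L s y ^ 2) * (∑ z, dps25R s z ^ 2) = a, |dps25P8 x s| ≤
        ∑ s with (∑ y, dps25L s y ^ 2) * (∑ z, dps25R s z ^ 2) = a, |dps25P8 0 s| := by
    decide +kernel
  have hrow : ∑ s, vecNorm 2 (dps25.L s) * vecNorm 2 (dps25.R s) * |dps25.P 0 s| =
      10 + 14 * √2 + 2 * √6 + 2 * √3 := by
    have e : ∀ b c : ℝ, 0 ≤ b → √(b ^ 2 * c) = b * √c := fun b c hb => by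
      rw [Real.sqrt_mul (by positivity), Real.sqrt_sq hb]
    have e8 : √(8 : ℝ) = 2 * √2 := by rw [← e _ _ (by norm_num)]; norm_num
    have e16 : √(16 : ℝ) = 4 * √1 := by rw [← e _ _ (by norm_num)]; norm_num
    have e24 : √(24 : ℝ) = 2 * √6 := by rw [← e _ _ (by norm_num)]; norm_num
    have e32 : √(32 : ℝ) = 4 * √2 := by rw [← e _ _ (by norm_num)]; norm_num
    have e48 : √(48 : ℝ) = 4 * √3 := by rw [← e _ _ (by norm_num)]; norm_num
    have e96 : √(96 : ℝ) = 4 * √6 := by rw [← e _ _ (by norm_num)]; norm_num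
    refine (intAlg_row_two dps25L dps25R dps25P8 _ ht 0).trans ?_
    have n : ∀ p ∈ [((8 : ℤ), (4 : ℤ)), (16, 12), (24, 4), (32, 10), (48, 4), (64, 4), (96, 2),
        (128, 8)], ∑ s with (∑ y, dps25L s y ^ 2) * (∑ z, dps25R s z ^ 2) = p.1,
          |dps25P8 0 s| = p.2 := by
      decide +kernel
    simp only [List.forall_mem_cons] at n
    obtain ⟨n8, n16, n24, n32, n48, n64, n96, n128, -⟩ := n
    repeat rw [Finset.sum_insert (by decide)]
    rw [Finset.sum_singleton, n8, n16, n24, n32, n48, n64, n96, n128]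
    push_cast
    rw [e8, e16, e24, e32, e48, sqrt_64, e96, sqrt_128, Real.sqrt_one]
    ring
  rw [LRP.growthFactor, conjExponent_two]
  refine vecNorm_top_eq (fun x => Finset.sum_nonneg fun s _ => ?_) (fun x => ?_) 0 hrow
  · exact mul_nonneg (mul_nonneg (vecNorm_nonneg _) (vecNorm_nonneg _)) (abs_nonneg _)
  · rw [← hrow]
    refine (intAlg_row_two dps25L dps25R dps25P8 _ ht x).trans_le
      (le_of_le_of_eq ?_ (intAlg_row_two dps25L dps25R dps25P8 _ ht 0).symm)
    exact Finset.sum_le_sum fun a ha =>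
      mul_le_mul_of_nonneg_left (Int.cast_le.2 (h a ha x)) (by positivity)

/-! ### Numerical values -/

/-- Taking logarithms of `b ^ a < x ^ d` turns a rational bound on a logarithm into a comparison of
powers. -/
theorem div_lt_logb {b x : ℝ} (hb : 1 < b) {a d : ℕ} (hd : 0 < d)
    (h : b ^ a < x ^ d) : (a : ℝ) / d < Real.logb b x := by
  have hd' : (0 : ℝ) < d := by exact_mod_cast hd
  have h1 := Real.logb_lt_logb hb (by positivity) h
  rw [Real.logb_pow, Real.logb_pow, Real.logb_self_eq_one hb, mul_one] at h1
  rw [div_lt_iff₀ hd']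
  linarith

theorem logb_lt_div {b x : ℝ} (hb : 1 < b) (hx : 0 < x) {a d : ℕ} (hd : 0 < d)
    (h : x ^ d < b ^ a) : Real.logb b x < (a : ℝ) / d := by
  have hd' : (0 : ℝ) < d := by exact_mod_cast hd
  have h1 := Real.logb_lt_logb hb (by positivity) h
  rw [Real.logb_pow, Real.logb_pow, Real.logb_self_eq_one hb, mul_one] at h1
  rw [lt_div_iff₀ hd']
  linarith

theorem logb_four_four_mul {x : ℝ} (hx : 0 < x) : Real.logb 4 (4 * x) = 1 + Real.logb 4 x := by
  rw [Real.logb_mul (by norm_num) hx.ne', Real.logb_self_eq_one (by norm_num)]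

theorem sqrt_two_bounds : 1.414213 < √(2 : ℝ) ∧ √(2 : ℝ) < 1.414214 :=
  ⟨Real.lt_sqrt_of_sq_lt (by norm_num), (Real.sqrt_lt' (by norm_num)).2 (by norm_num)⟩

theorem sqrt_three_bounds : 1.73205 < √(3 : ℝ) ∧ √(3 : ℝ) < 1.73206 :=
  ⟨Real.lt_sqrt_of_sq_lt (by norm_num), (Real.sqrt_lt' (by norm_num)).2 (by norm_num)⟩

theorem sqrt_six_bounds : 2.44948 < √(6 : ℝ) ∧ √(6 : ℝ) < 2.4495 :=
  ⟨Real.lt_sqrt_of_sq_lt (by norm_num), (Real.sqrt_lt' (by norm_num)).2 (by norm_num)⟩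

theorem logb_four_224_bounds : 3.903 < Real.logb 4 224 ∧ Real.logb 4 224 < 3.905 := by
  -- The fractions `121 / 31 ≈ 3.9032` and `82 / 21 ≈ 3.9048` lie inside the required window, on
  -- either side of the logarithm, and have small denominators.
  have h1 := div_lt_logb (b := 4) (x := 224) (by norm_num) (a := 121) (d := 31)
    (by norm_num) (by norm_num)
  have h2 := logb_lt_div (b := 4) (x := 224) (by norm_num) (by norm_num) (a := 82) (d := 21)
    (by norm_num) (by norm_num)
  norm_num at h1 h2 ⊢
  constructor <;> linarith

theorem logb_four_growthFactor_bounds :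
    2.385 < Real.logb 4 (16 + 8 * √2) ∧ Real.logb 4 (16 + 8 * √2) < 2.387 := by
  obtain ⟨hl, hu⟩ := sqrt_two_bounds
  have h1 := div_lt_logb (b := 4) (x := 27.313) (by norm_num) (a := 198) (d := 83)
    (by norm_num) (by norm_num)
  have h2 := logb_lt_div (b := 4) (x := 27.314) (by norm_num) (by norm_num) (a := 105) (d := 44)
    (by norm_num) (by norm_num)
  have h3 : Real.logb 4 27.313 < Real.logb 4 (16 + 8 * √2) :=
    Real.logb_lt_logb (by norm_num) (by norm_num) (by linarith)
  have h4 : Real.logb 4 (16 + 8 * √2) < Real.logb 4 27.314 :=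
    Real.logb_lt_logb (by norm_num) (by positivity) (by linarith)
  norm_num at h1 h2 h3 h4 ⊢
  constructor <;> linarith

theorem five_halves_lt_logb {b x : ℝ} (hb : 1 < b) (h : b ^ 5 < x ^ 2) :
    2.5 < Real.logb b x := by
  have := div_lt_logb hb (a := 5) (d := 2) (by norm_num) h
  norm_num at this ⊢
  exact this

theorem mainTheorem2 :
    -- the new algorithm: correctness and growth factors
    newAlg.IsMatMul ∧
    newAlg.growthFactor ∞ ∞ = 224 ∧
    newAlg.growthFactor ∞ 2 = 16 + 8 * √2 ∧
    newAlg.growthFactor 2 ∞ = 896 ∧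
    newAlg.growthFactor 2 2 = 64 + 32 * √2 ∧
    |newAlg.growthFactor ∞ 2 - 27.314| < 0.001 ∧
    |newAlg.growthFactor 2 2 - 109.26| < 0.01 ∧
    -- the new algorithm: forward error bounds
    newAlg.HasForwardErrorBound ∞ ∞ ∧
    newAlg.HasForwardErrorBound ∞ 2 ∧
    newAlg.HasForwardErrorBound 2 ∞ ∧
    newAlg.HasForwardErrorBound 2 2 ∧
    |newAlg.errorExponent ∞ ∞ - 3.904| < 0.001 ∧
    |newAlg.errorExponent ∞ 2 - 2.386| < 0.001 ∧
    |newAlg.errorExponent 2 ∞ - 4.904| < 0.001 ∧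
    |newAlg.errorExponent 2 2 - 3.386| < 0.001 ∧
    -- the algorithms of the comparison
    (winograd.IsMatMul ∧ strassen.IsMatMul ∧ dps24.IsMatMul ∧ dps25.IsMatMul) ∧
    (winograd.HasForwardErrorBound ∞ 2 ∧ strassen.HasForwardErrorBound ∞ 2 ∧
      dps24.HasForwardErrorBound ∞ 2 ∧ dps25.HasForwardErrorBound ∞ 2) ∧
    (winograd.growthFactor ∞ 2 = 8 ∧ |strassen.growthFactor ∞ 2 - 6.829| < 0.001 ∧
      |dps24.growthFactor ∞ 2 - 5.966| < 0.001 ∧ |dps25.growthFactor ∞ 2 - 38.163| < 0.001) ∧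
    -- the new algorithm has the least exponent
    newAlg.errorExponent ∞ 2 < winograd.errorExponent ∞ 2 ∧
    newAlg.errorExponent ∞ 2 < strassen.errorExponent ∞ 2 ∧
    newAlg.errorExponent ∞ 2 < dps24.errorExponent ∞ 2 ∧
    newAlg.errorExponent ∞ 2 < dps25.errorExponent ∞ 2 := by
  obtain ⟨hl2, hu2⟩ := sqrt_two_bounds
  obtain ⟨hl3, hu3⟩ := sqrt_three_bounds
  obtain ⟨hl6, hu6⟩ := sqrt_six_bounds
  obtain ⟨ha1, ha2⟩ := logb_four_224_bounds
  obtain ⟨hb1, hb2⟩ := logb_four_growthFactor_bounds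
  have g1 := newAlg_growthFactor_top_top
  have g2 := newAlg_growthFactor_top_two
  have g3 := newAlg_growthFactor_two_top
  have g4 := newAlg_growthFactor_two_two
  have gw := winograd_growthFactor
  have gs := strassen_growthFactor
  have gd := dps24_growthFactor
  have gq := dps25_growthFactor
  have x1 : newAlg.errorExponent ∞ ∞ = Real.logb 4 224 := by
    rw [LRP.errorExponent, g1, Nat.cast_ofNat]
  have x2 : newAlg.errorExponent ∞ 2 = Real.logb 4 (16 + 8 * √2) := by
    rw [LRP.errorExponent, g2, Nat.cast_ofNat]
  -- The factor `4 = √16` from the sixteen equal entries shifts the base-`4` exponent by exactly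
  -- `1`.
  have x3 : newAlg.errorExponent 2 ∞ = 1 + Real.logb 4 224 := by
    rw [LRP.errorExponent, g3, Nat.cast_ofNat, ← logb_four_four_mul (by norm_num)]
    norm_num
  have x4 : newAlg.errorExponent 2 2 = 1 + Real.logb 4 (16 + 8 * √2) := by
    rw [LRP.errorExponent, g4, Nat.cast_ofNat, ← logb_four_four_mul (by positivity)]
    ring_nf
  -- The value `5 / 2` separates the new exponent from the other four: those need only `2 ^ 5 < γ ^
  -- 2` or `4 ^ 5 < γ ^ 2`.
  have hlt : newAlg.errorExponent ∞ 2 < 2.5 := by rw [x2]; linarith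
  have top : (∞ : ℝ≥0∞) = 2 ∨ (∞ : ℝ≥0∞) = ∞ := .inr rfl
  refine ⟨newAlg_isMatMul, g1, g2, g3, g4, ?_, ?_,
    LRP.hasForwardErrorBound_top_top newAlg_isMatMul (by norm_num) (by rw [g1]; norm_num),
    LRP.hasForwardErrorBound_two newAlg_isMatMul top (by norm_num) (by rw [g2]; linarith),
    LRP.hasForwardErrorBound_two_top newAlg_isMatMul (by norm_num) ?_,
    LRP.hasForwardErrorBound_two newAlg_isMatMul (.inl rfl) (by norm_num) (by rw [g4]; linarith),
    ?_, ?_, ?_, ?_,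
    ⟨winograd_isMatMul, strassen_isMatMul, dps24_isMatMul, dps25_isMatMul⟩,
    ⟨LRP.hasForwardErrorBound_two winograd_isMatMul top (by norm_num) (by rw [gw]; norm_num),
      LRP.hasForwardErrorBound_two strassen_isMatMul top (by norm_num) (by rw [gs]; linarith),
      LRP.hasForwardErrorBound_two dps24_isMatMul top (by norm_num) (by rw [gd]; linarith),
      LRP.hasForwardErrorBound_two dps25_isMatMul top (by norm_num) (by rw [gq]; linarith)⟩,
    ⟨gw, ?_, ?_, ?_⟩, hlt.trans ?_, hlt.trans ?_, hlt.trans ?_, hlt.trans ?_⟩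
  · rw [g2, abs_lt]; constructor <;> linarith
  · rw [g4, abs_lt]; constructor <;> linarith
  · rw [g3, Nat.cast_ofNat, Real.sqrt_mul_self (by norm_num)]; norm_num
  · rw [x1, abs_lt]; constructor <;> linarith
  · rw [x2, abs_lt]; constructor <;> linarith
  · rw [x3, abs_lt]; constructor <;> linarith
  · rw [x4, abs_lt]; constructor <;> linarith
  · rw [gs, abs_lt]; constructor <;> linarith
  · rw [gd, abs_lt]; constructor <;> linarith
  · rw [gq, abs_lt]; constructor <;> linarith
  · rw [LRP.errorExponent, gw, Nat.cast_ofNat]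
    exact five_halves_lt_logb (by norm_num) (by norm_num)
  · rw [LRP.errorExponent, gs, Nat.cast_ofNat]
    exact five_halves_lt_logb (by norm_num) (by nlinarith)
  · rw [LRP.errorExponent, gd, Nat.cast_ofNat]
    exact five_halves_lt_logb (by norm_num) (by nlinarith)
  · rw [LRP.errorExponent, gq, Nat.cast_ofNat]
    exact five_halves_lt_logb (by norm_num) (by nlinarith)
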